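/- Let $n\ge 1$, $\alpha=(\alpha_1,\dots,\alpha_n)\in(0,\infty)^n$, $\alpha_0>0$, $|\alpha|=\sum_{i=1}^n\alpha_i$, and $s(x)=\sum_{i=1}^n x_i$. The inverted Dirichlet distribution $\Pi^{\mathrm{inv}}_{\alpha,\alpha_0}$ is the probability measure on $\mathbb{R}_+^n=(0,\infty)^n$ with Lebesgue density $$Z^{-1}\prod_{i=1}^n x_i^{\alpha_i-1}\,(1+s(x))^{-(|\alpha|+\alpha_0)},$$ and the Dirichlet distribution $\Pi_{\tilde\alpha}$, $\tilde\alpha=(\alpha_1,\dots,\alpha_n,\alpha_0)$, is the probability measure on the open simplex $\mathcal V_n=\{t\in(0,1)^n:\sum_{i=1}^n t_i<1\}$ with Lebesgue density $Z^{-1}\prod_{i=1}^n t_i^{\alpha_i-1}\,(1-\sum_{i=1}^n t_i)^{\alpha_0-1}$, where in each case $Z$ is the normalizing constant. (i) The map $T(t)=t/(1-\sum_{i=1}^n t_i)$ is a smooth diffeomorphism from $\mathcal V_n$ onto $\mathbb{R}_+^n$ with inverse $T^{-1}(x)=x/(1+s(x))$, and $\Pi^{\mathrm{inv}}_{\alpha,\alpha_0}=T_\#\Pi_{\tilde\alpha}$.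 With $W_\tau(t)=\mathrm{diag}(t)-t\,t^\top$ on $\mathcal V_n$ and $\mathrm{Jac}(T)$ the Jacobian matrix of $T$, the transported weight is, for all $x\in\mathbb{R}_+^n$, $$W(x):=(1+s(x))\left(\mathrm{diag}(x)+x\,x^\top\right)=\left(\mathrm{Jac}(T)\,W_\tau\,\mathrm{Jac}(T)^\top\right)\circ T^{-1}(x),$$ and it is symmetric positive definite. (ii) For every $f\in L^2(\Pi^{\mathrm{inv}}_{\alpha,\alpha_0})$ that has weak partial derivatives $\partial_i f\in L^1_{\mathrm{loc}}(\mathbb{R}_+^n)$ and for which the integral on the right is finite, $$\int f^2\,d\Pi^{\mathrm{inv}}_{\alpha,\alpha_0}-\Big(\int f\,d\Pi^{\mathrm{inv}}_{\alpha,\alpha_0}\Big)^2\le\frac{1}{|\alpha|+\alpha_0}\int_{\mathbb{R}_+^n}(1+s(x))\Big(\sum_{i=1}^n x_i(\partial_i f(x))^2+\Big(\sum_{i=1}^n x_i\,\partial_i f(x)\Big)^2\Big)\,d\Pi^{\mathrm{inv}}_{\alpha,\alpha_0}(x).$$ The integrand on the right is $\langle W\nabla f,\nabla f\rangle$. (iii)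 The constant is optimal: $1/(|\alpha|+\alpha_0)$ is the smallest $C>0$ such that $\mathrm{Var}(f)\le C\int\langle W\nabla f,\nabla f\rangle\,d\Pi^{\mathrm{inv}}_{\alpha,\alpha_0}$ holds for all such $f$. -/

import Mathlib

open MeasureTheory
open scoped ContDiff

namespace InvDirichlet

/-- The strictly positive orthant `(0,∞)ⁿ`. -/
def orthant (n : ℕ) : Set (Fin n → ℝ) := {x | ∀ i, 0 < x i}

/-- The open simplex `{t ∈ (0,1)ⁿ : t₁ + ⋯ + tₙ < 1}`. -/
def openSimplex (n : ℕ) : Set (Fin n → ℝ) := {t | (∀ i, 0 < t i ∧ t i < 1) ∧ ∑ i, t i < 1}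

/-- The measure on `Ω` with density `Z⁻¹ ρ` with respect to Lebesgue measure,
where `Z = ∫_Ω ρ` (for a nonnegative function `ρ`). -/
noncomputable def normalizedMeasure {n : ℕ} (Ω : Set (Fin n → ℝ)) (ρ : (Fin n → ℝ) → ℝ) :
    Measure (Fin n → ℝ) :=
  (∫⁻ x in Ω, ENNReal.ofReal (ρ x))⁻¹ •
    (volume.restrict Ω).withDensity (fun x => ENNReal.ofReal (ρ x))

/-- The Dirichlet distribution on the open simplex of `ℝⁿ`, with parameter vector
`β = (β₁, …, βₙ, βₙ₊₁)`. -/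
noncomputable def dirichlet {n : ℕ} (β : Fin (n + 1) → ℝ) : Measure (Fin n → ℝ) :=
  normalizedMeasure (openSimplex n) fun t =>
    (∏ i : Fin n, t i ^ (β i.castSucc - 1)) * (1 - ∑ i, t i) ^ (β (Fin.last n) - 1)

/-- The inverted Dirichlet distribution on the positive orthant. -/
noncomputable def invDirichlet {n : ℕ} (α : Fin n → ℝ) (α₀ : ℝ) : Measure (Fin n → ℝ) :=
  normalizedMeasure (orthant n) fun x =>
    (∏ i, x i ^ (α i - 1)) * (1 + ∑ i, x i) ^ (-((∑ i, α i) + α₀))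

/-- `g` is the gradient of weak partial derivatives of `f` on the open set `Ω`. -/
structure IsWeakGradient {n : ℕ} (Ω : Set (Fin n → ℝ)) (f : (Fin n → ℝ) → ℝ)
    (g : (Fin n → ℝ) → Fin n → ℝ) : Prop where
  locallyIntegrableOn : LocallyIntegrableOn f Ω volume
  locallyIntegrableOn_grad : ∀ i, LocallyIntegrableOn (fun x => g x i) Ω volume
  integral_eq : ∀ (i : Fin n) (φ : (Fin n → ℝ) → ℝ),
    ContDiff ℝ ∞ φ → HasCompactSupport φ → tsupport φ ⊆ Ω →
      ∫ x in Ω, f x * fderiv ℝ φ x (Pi.single i 1) = - ∫ x in Ω, g x i * φ x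

/-- The squared norm `‖v‖²_A = ⟨A v, v⟩`. -/
def sqNorm {n : ℕ} (A : Matrix (Fin n) (Fin n) ℝ) (v : Fin n → ℝ) : ℝ :=
  (A.mulVec v) ⬝ᵥ v

/-- The probability measure `μ` on `Ω` satisfies the weighted Poincaré inequality with weight `W`
and constant `C > 0`: `Var_μ(f) ≤ C ∫ ‖∇f‖²_W dμ` for every weakly differentiable
`f ∈ L²(μ)` for which the right-hand side is finite. -/
def WeightedPoincare {n : ℕ} (Ω : Set (Fin n → ℝ)) (μ : Measure (Fin n → ℝ))
    (W : (Fin n → ℝ) → Matrix (Fin n) (Fin n) ℝ) (C : ℝ) : Prop :=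
  0 < C ∧ ∀ (f : (Fin n → ℝ) → ℝ) (g : (Fin n → ℝ) → Fin n → ℝ),
    MemLp f 2 μ → IsWeakGradient Ω f g → Integrable (fun x => sqNorm (W x) (g x)) μ →
      ∫ x, f x ^ 2 ∂μ - (∫ x, f x ∂μ) ^ 2 ≤ C * ∫ x, sqNorm (W x) (g x) ∂μ

/-- The weight `W(x) = (1 + s(x)) (diag(x) + x xᵀ)`, with `s(x) = x₁ + ⋯ + xₙ`. -/
noncomputable def invWeight {n : ℕ} (x : Fin n → ℝ) : Matrix (Fin n) (Fin n) ℝ :=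
  (1 + ∑ i, x i) • (Matrix.diagonal x + Matrix.vecMulVec x x)

/-- The weight `W_τ(t) = diag(t) - t tᵀ` on the simplex. -/
def simplexWeight {n : ℕ} (t : Fin n → ℝ) : Matrix (Fin n) (Fin n) ℝ :=
  Matrix.diagonal t - Matrix.vecMulVec t t

/-- The map `T(t) = t / (1 - (t₁ + ⋯ + tₙ))`. -/
noncomputable def transport {n : ℕ} (t : Fin n → ℝ) : Fin n → ℝ := (1 - ∑ i, t i)⁻¹ • t

/-- The map `x ↦ x / (1 + s(x))`, inverse of `transport`. -/
noncomputable def transportInv {n : ℕ} (x : Fin n → ℝ) : Fin n → ℝ := (1 + ∑ i, x i)⁻¹ • x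

/-- The Jacobian matrix of `F` at `t`. -/
noncomputable def jacobian {n : ℕ} (F : (Fin n → ℝ) → Fin n → ℝ) (t : Fin n → ℝ) :
    Matrix (Fin n) (Fin n) ℝ :=
  LinearMap.toMatrix' (fderiv ℝ F t : (Fin n → ℝ) →ₗ[ℝ] (Fin n → ℝ))

end InvDirichlet

/-! In the simplex coordinates u = x/(1+s(x)) the inequality is the spectral gap of the
Wright–Fisher generator L. With A = |α|+α₀, L sends a polynomial in u of degree at most m+1 to
-(m+1)(A+m) times itself plus terms of degree at most m (`generator_add_mem`). L is symmetric in L²,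
so it is diagonal along the orthogonal degree filtration, and its smallest nonzero eigenvalue in
absolute value is A, in degree one (`spectral_gap_of_triangular`).

To reach every weakly differentiable f of finite energy E, no density of smooth functions in the
energy norm is needed. Green's formula ∫⟨W g, ∇p⟩ = -∫ f Lp holds for f itself and polynomials p in
u (`integral_energyForm_polyGrad`), and nonnegativity of the energy of g - ∇p gives 0 ≤ E + 2⟨f, Lp⟩
- ⟨p, Lp⟩. If p is the L² projection of f on polynomials of degree at most k, then ⟨f, Lp⟩ = ⟨p,
Lp⟩, so E ≥ -⟨p, Lp⟩ ≥ A Var(p). Polynomials in u are dense in L² (`exists_eval_transportInv_near`),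
so letting k grow yields E ≥ A Var(f) (`poincare_of_triangular`).

Green's formula has no boundary term because W∇p has components xᵢ ∂ᵢp(u), and cutoffs can be chosen
with xᵢ∂ᵢ of the cutoff uniformly bounded. Optimality comes from u₁, which after centring is an
eigenfunction for -A. -/

namespace InvDirichlet

/-! ### The generator on polynomials and its triangularity in the degree. -/

section Algebra

open MvPolynomial

variable {n : ℕ}

/-- The Euler operator `∑ᵢ Xᵢ ∂ᵢ`. -/
noncomputable def eulerOp : MvPolynomial (Fin n) ℝ →ₗ[ℝ] MvPolynomial (Fin n) ℝ :=
  ∑ i, (LinearMap.mulLeft ℝ (X i)) ∘ₗ (pderiv i).toLinearMap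

lemma eulerOp_apply (p : MvPolynomial (Fin n) ℝ) : eulerOp p = ∑ i, X i * pderiv i p := by
  simp [eulerOp]

/-- `∂ᵢ (p ∘ τ) = (gradOp i p ∘ τ) / (1 + s)` for the inverse transport map `τ`. -/
noncomputable def gradOp (i : Fin n) : MvPolynomial (Fin n) ℝ →ₗ[ℝ] MvPolynomial (Fin n) ℝ :=
  (pderiv i).toLinearMap - eulerOp

lemma gradOp_apply (i : Fin n) (p : MvPolynomial (Fin n) ℝ) :
    gradOp i p = pderiv i p - eulerOp p := rfl

/-- The weighted divergence `ρ⁻¹ ∂ᵢ (ρ xᵢ (q ∘ τ)) = divOp α A i q ∘ τ`. -/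
noncomputable def divOp (α : Fin n → ℝ) (A : ℝ) (i : Fin n) :
    MvPolynomial (Fin n) ℝ →ₗ[ℝ] MvPolynomial (Fin n) ℝ :=
  α i • LinearMap.id - A • LinearMap.mulLeft ℝ (X i) + (LinearMap.mulLeft ℝ (X i)) ∘ₗ gradOp i

lemma divOp_apply (α : Fin n → ℝ) (A : ℝ) (i : Fin n) (p : MvPolynomial (Fin n) ℝ) :
    divOp α A i p = α i • p - A • (X i * p) + X i * gradOp i p := rfl

/-- The generator of the (Wright–Fisher) diffusion, acting on polynomials on the simplex. -/
noncomputable def generator (α : Fin n → ℝ) (A : ℝ) :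
    MvPolynomial (Fin n) ℝ →ₗ[ℝ] MvPolynomial (Fin n) ℝ :=
  ∑ i, divOp α A i ∘ₗ (pderiv i).toLinearMap

lemma generator_apply (α : Fin n → ℝ) (A : ℝ) (p : MvPolynomial (Fin n) ℝ) :
    generator α A p = ∑ i, divOp α A i (pderiv i p) := by
  simp [generator]

/-- Polynomials of total degree at most `m`. -/
noncomputable def degreeLE (n m : ℕ) : Submodule ℝ (MvPolynomial (Fin n) ℝ) :=
  Submodule.span ℝ ((fun a : Fin n →₀ ℕ => monomial a (1 : ℝ)) '' {a | a.degree ≤ m})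

lemma monomial_mem_degreeLE {a : Fin n →₀ ℕ} {m : ℕ} (h : a.degree ≤ m) :
    monomial a (1 : ℝ) ∈ degreeLE n m :=
  Submodule.subset_span ⟨a, h, rfl⟩

lemma degreeLE_mono : Monotone (degreeLE n) := fun _ _ h =>
  Submodule.span_mono (Set.image_mono fun _ ha => le_trans ha h)

instance finiteDimensional_degreeLE (m : ℕ) : FiniteDimensional ℝ (degreeLE n m) :=
  FiniteDimensional.span_of_finite ℝ ((Finsupp.finite_of_degree_le m).image _)

lemma exists_mem_degreeLE (p : MvPolynomial (Fin n) ℝ) : ∃ m, p ∈ degreeLE n m := by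
  induction p using MvPolynomial.induction_on' with
  | monomial a r =>
    refine ⟨a.degree, ?_⟩
    have := (degreeLE n a.degree).smul_mem r (monomial_mem_degreeLE le_rfl)
    simpa [smul_monomial] using this
  | add p q hp hq =>
    obtain ⟨k, hk⟩ := hp
    obtain ⟨l, hl⟩ := hq
    exact ⟨max k l, Submodule.add_mem _ (degreeLE_mono (le_max_left _ _) hk)
      (degreeLE_mono (le_max_right _ _) hl)⟩

lemma mem_degreeLE_zero {p : MvPolynomial (Fin n) ℝ} (hp : p ∈ degreeLE n 0) : ∃ c, p = C c := by
  induction hp using Submodule.span_induction with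
  | mem x hx =>
    obtain ⟨a, ha, rfl⟩ := hx
    have : a = 0 := (Finsupp.degree_eq_zero_iff a).1 (Nat.le_zero.1 ha)
    exact ⟨1, by simp [this]⟩
  | zero => exact ⟨0, by simp⟩
  | add x y _ _ hx hy =>
    obtain ⟨c, rfl⟩ := hx
    obtain ⟨d, rfl⟩ := hy
    exact ⟨c + d, by simp⟩
  | smul r x _ hx =>
    obtain ⟨c, rfl⟩ := hx
    exact ⟨r * c, by simp [smul_eq_C_mul]⟩

lemma eulerOp_monomial (a : Fin n →₀ ℕ) (r : ℝ) :
    eulerOp (monomial a r) = (a.degree : ℝ) • monomial a r := by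
  simp only [eulerOp_apply, X_mul_pderiv_monomial, ← Finset.sum_smul]
  rw [Finsupp.degree_eq_sum, ← Nat.cast_smul_eq_nsmul ℝ]

/-- With b = a - eᵢ, the Euler operator multiplies X^b by |b|, so `divOp` sends X^b to (αᵢ+bᵢ) X^b -
(A+|b|) X^a; the factor aᵢ comes from the inner derivative. -/
lemma divOp_pderiv_monomial (α : Fin n → ℝ) (A : ℝ) (i : Fin n) (a : Fin n →₀ ℕ) :
    divOp α A i (pderiv i (monomial a 1)) =
      (a i * (α i + a i - 1) : ℝ) • monomial (a - Finsupp.single i 1) 1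
        - (a i * (A + a.degree - 1) : ℝ) • monomial a (1 : ℝ) := by
  -- If aᵢ = 0 the truncated exponent a - eᵢ is meaningless, but both coefficients vanish.
  obtain h | h := Nat.eq_zero_or_pos (a i)
  · simp [pderiv_monomial, h]
  · obtain ⟨b, rfl⟩ : ∃ b, a = b + Finsupp.single i 1 := by
      refine ⟨a - Finsupp.single i 1, (tsub_add_cancel_of_le ?_).symm⟩
      simpa using Nat.one_le_iff_ne_zero.2 h.ne'
    have hX : ∀ r : ℝ, X i * monomial b r = monomial (b + Finsupp.single i 1) r := fun r => by
      rw [X, monomial_mul, one_mul, add_comm]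
    have hd : ((b + Finsupp.single i 1).degree : ℝ) = b.degree + 1 := by
      simp
    rw [pderiv_monomial, add_tsub_cancel_right, divOp_apply, gradOp_apply, mul_sub,
      X_mul_pderiv_monomial, eulerOp_monomial, mul_smul_comm, hX, hd, ← Nat.cast_smul_eq_nsmul ℝ]
    have e1 : ∀ (c : Fin n →₀ ℕ), ∃ Q, ∀ x : ℝ, monomial c x = x • Q := fun c =>
      ⟨monomial c 1, fun x => by rw [smul_monomial, smul_eq_mul, mul_one]⟩
    obtain ⟨P, hP⟩ := e1 b
    obtain ⟨Q, hQ⟩ := e1 (b + Finsupp.single i 1)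
    simp only [hP, hQ, Finsupp.add_apply, Finsupp.single_eq_same, Nat.cast_add, Nat.cast_one]
    module

/-- Summed over i, the coefficients of X^a add up to -|a|(A+|a|-1), and what remains has degree
|a|-1. For a = 0 nothing remains, so truncated subtraction is harmless. -/
lemma generator_monomial_add (α : Fin n → ℝ) (A : ℝ) (a : Fin n →₀ ℕ) :
    generator α A (monomial a 1) + (a.degree * (A + a.degree - 1) : ℝ) • monomial a (1 : ℝ)
      ∈ degreeLE n (a.degree - 1) := by
  have h : (a.degree : ℝ) = ∑ i, (a i : ℝ) := by rw [Finsupp.degree_eq_sum]; push_cast; rfl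
  have : generator α A (monomial a 1)
      + (a.degree * (A + a.degree - 1) : ℝ) • monomial a (1 : ℝ) =
      ∑ i, (a i * (α i + a i - 1) : ℝ) • monomial (a - Finsupp.single i 1) (1 : ℝ) := by
    simp only [generator_apply, divOp_pderiv_monomial, Finset.sum_sub_distrib, ← Finset.sum_smul,
      ← Finset.sum_mul, ← h]
    abel
  rw [this]
  refine Submodule.sum_mem _ fun i _ => ?_
  obtain h | h := Nat.eq_zero_or_pos (a i)
  · simp [h]
  · refine Submodule.smul_mem _ _ (monomial_mem_degreeLE ?_)
    obtain ⟨b, rfl⟩ : ∃ b, a = b + Finsupp.single i 1 := by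
      refine ⟨a - Finsupp.single i 1, (tsub_add_cancel_of_le ?_).symm⟩
      simpa using Nat.one_le_iff_ne_zero.2 h.ne'
    simp

lemma generator_add_mem (α : Fin n → ℝ) (A : ℝ) {m : ℕ} {p : MvPolynomial (Fin n) ℝ}
    (hp : p ∈ degreeLE n (m + 1)) :
    generator α A p + ((m + 1) * (A + m) : ℝ) • p ∈ degreeLE n m := by
  induction hp using Submodule.span_induction with
  | mem x hx =>
    obtain ⟨a, ha, rfl⟩ := hx
    have h := generator_monomial_add α A a
    obtain h1 | h1 := Nat.lt_or_ge a.degree (m + 1)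
    · have h2 : monomial a (1 : ℝ) ∈ degreeLE n m := monomial_mem_degreeLE (by omega)
      have h3 := degreeLE_mono (show a.degree - 1 ≤ m by omega) h
      have := Submodule.add_mem _ (Submodule.sub_mem _ h3
        (Submodule.smul_mem _ (a.degree * (A + a.degree - 1) : ℝ) h2))
        (Submodule.smul_mem _ ((m + 1) * (A + m) : ℝ) h2)
      simpa using this
    · have h2 : a.degree = m + 1 := le_antisymm ha h1
      rw [h2] at h
      rwa [show ((m + 1 : ℕ) : ℝ) * (A + (m + 1 : ℕ) - 1) = (m + 1) * (A + m) by
        push_cast; ring] at h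
  | zero => simp
  | add x y _ _ hx hy =>
    have := Submodule.add_mem _ hx hy
    convert this using 1
    simp only [map_add]
    module
  | smul r x _ hx =>
    have := Submodule.smul_mem _ r hx
    convert this using 1
    simp only [map_smul]
    module

lemma generator_C (α : Fin n → ℝ) (A c : ℝ) : generator α A (C c) = 0 := by
  simp [generator_apply]

end Algebra

/-! ### Abstract spectral gap and Poincaré inequality for a triangular symmetric operator. -/

section Hilbert

open scoped InnerProductSpace

variable {P H : Type*} [AddCommGroup P] [Module ℝ P] [NormedAddCommGroup H]
  [InnerProductSpace ℝ H]

/-- Project on the finite-dimensional image ι(U) and lift the projection to U; ι need not be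
injective. -/
lemma exists_orthogonal_split (ι : P →ₗ[ℝ] H) (U : Submodule ℝ P) [FiniteDimensional ℝ U] (x : H) :
    ∃ q ∈ U, ∀ r ∈ U, ⟪x - ι q, ι r⟫_ℝ = 0 := by
  have hK := (U.map ι).starProjection_apply_mem x
  obtain ⟨q, hq, hqx⟩ := hK
  refine ⟨q, hq, fun r hr => ?_⟩
  rw [hqx]
  exact (U.map ι).starProjection_inner_eq_zero x _ (Submodule.mem_map_of_mem hr)

/-- Spectral gap on a filtered space on which a symmetric operator acts triangularly. -/
theorem spectral_gap_of_triangular (ι : P →ₗ[ℝ] H) (L : P →ₗ[ℝ] P) (U : ℕ → Submodule ℝ P)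
    [∀ m, FiniteDimensional ℝ (U m)] (hU : Monotone U) (A : ℝ) (hA : 0 < A) (e : P)
    (he : ‖ι e‖ = 1) (hL0 : L e = 0) (he0 : e ∈ U 0) (hU0 : ∀ p ∈ U 0, ∃ c : ℝ, p = c • e)
    (hsymm : ∀ p q, ⟪ι p, ι (L q)⟫_ℝ = ⟪ι (L p), ι q⟫_ℝ)
    (htri : ∀ m : ℕ, ∀ p ∈ U (m + 1), L p + ((m + 1) * (A + m) : ℝ) • p ∈ U m) (m : ℕ) :
    ∀ p ∈ U m, A * (‖ι p‖ ^ 2 - ⟪ι p, ι e⟫_ℝ ^ 2) ≤ -⟪ι p, ι (L p)⟫_ℝ := by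
  induction m with
  | zero =>
    intro p hp
    obtain ⟨c, rfl⟩ := hU0 p hp
    simp [hL0, norm_smul, he, inner_smul_left]
  | succ m ih =>
    intro p hp
    have hL : ∀ q ∈ U m, L q ∈ U m := fun q hq => by
      have := htri m q (hU m.le_succ hq)
      simpa using (U m).sub_mem this ((U m).smul_mem ((m + 1) * (A + m) : ℝ) hq)
    obtain ⟨q, hq, hr⟩ := exists_orthogonal_split ι (U m) (ι p)
    obtain ⟨r, rfl⟩ : ∃ r, p = q + r := ⟨p - q, by simp⟩
    have hr' : r ∈ U (m + 1) := by
      simpa using (U (m + 1)).sub_mem hp (hU m.le_succ hq)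
    simp only [map_add, add_sub_cancel_left] at hr
    -- Modulo `U m`, to which r is orthogonal, L r is -(m+1)(A+m) r. Symmetry and stability of `U m`
    -- then remove the cross terms.
    have h1 : ⟪ι r, ι (L r)⟫_ℝ = -((m + 1) * (A + m) * ‖ι r‖ ^ 2) := by
      have := hr _ (htri m r hr')
      rw [map_add, inner_add_right, map_smul, inner_smul_right, real_inner_self_eq_norm_sq] at this
      linarith
    have h2 : ⟪ι q, ι (L r)⟫_ℝ = 0 := by
      rw [hsymm, real_inner_comm]; exact hr _ (hL q hq)
    have h3 : ⟪ι r, ι (L q)⟫_ℝ = 0 := hr _ (hL q hq)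
    have h4 : ⟪ι r, ι q⟫_ℝ = 0 := hr _ hq
    have h5 : ⟪ι r, ι e⟫_ℝ = 0 := hr _ (hU m.zero_le he0)
    have h6 := ih q hq
    have h7 : ‖ι q + ι r‖ ^ 2 = ‖ι q‖ ^ 2 + ‖ι r‖ ^ 2 := by
      rw [norm_add_sq_real, real_inner_comm, h4]; ring
    simp only [map_add, inner_add_left, inner_add_right, h1, h2, h3, h5, h7]
    -- The eigenvalues increase with the degree, so the gap is the one at m = 0.
    have h8 : A ≤ (m + 1) * (A + m) := by
      have : (0 : ℝ) ≤ m := m.cast_nonneg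
      nlinarith [mul_nonneg this hA.le, mul_nonneg this this]
    nlinarith [mul_le_mul_of_nonneg_right h8 (sq_nonneg ‖ι r‖)]

/-- The Poincaré inequality for an element `F` of energy `E` which can be tested against a dense
family on which the generator acts triangularly. -/
theorem poincare_of_triangular (ι : P →ₗ[ℝ] H) (L : P →ₗ[ℝ] P) (U : ℕ → Submodule ℝ P)
    [∀ m, FiniteDimensional ℝ (U m)] (hU : Monotone U) (hUtop : ∀ p, ∃ m, p ∈ U m)
    (A : ℝ) (hA : 0 < A) (e : P)
    (he : ‖ι e‖ = 1) (hL0 : L e = 0) (he0 : e ∈ U 0) (hU0 : ∀ p ∈ U 0, ∃ c : ℝ, p = c • e)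
    (hsymm : ∀ p q, ⟪ι p, ι (L q)⟫_ℝ = ⟪ι (L p), ι q⟫_ℝ)
    (htri : ∀ m : ℕ, ∀ p ∈ U (m + 1), L p + ((m + 1) * (A + m) : ℝ) • p ∈ U m)
    (F : H) (hF : ∀ ε > 0, ∃ p, ‖F - ι p‖ < ε) (E : ℝ)
    (hE : ∀ p, 0 ≤ E + 2 * ⟪F, ι (L p)⟫_ℝ - ⟪ι p, ι (L p)⟫_ℝ) :
    A * (‖F‖ ^ 2 - ⟪F, ι e⟫_ℝ ^ 2) ≤ E := by
  refine le_of_forall_pos_le_add fun ε hε => ?_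
  obtain ⟨p₀, hp₀⟩ := hF (√(ε / A)) (by positivity)
  obtain ⟨k, hk⟩ := hUtop p₀
  -- Passing to k+1 lets the triangularity hypothesis show that the space is stable under L.
  have hk := hU k.le_succ hk
  obtain ⟨p, hp, hperp⟩ := exists_orthogonal_split ι (U (k + 1)) F
  have hLp : L p ∈ U (k + 1) := by
    have := hU k.le_succ (htri k p hp)
    simpa using (U (k + 1)).sub_mem this ((U (k + 1)).smul_mem ((k + 1) * (A + k) : ℝ) hp)
  have hgap := spectral_gap_of_triangular ι L U hU A hA e he hL0 he0 hU0 hsymm htri (k + 1) p hp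
  -- As L p stays in the space projected on, F may be replaced by p; the energy hypothesis becomes
  -- -⟨p, Lp⟩ ≤ E.
  have h1 : ⟪F, ι (L p)⟫_ℝ = ⟪ι p, ι (L p)⟫_ℝ := by
    have := hperp _ hLp
    rwa [inner_sub_left, sub_eq_zero] at this
  have h2 : ⟪F, ι e⟫_ℝ = ⟪ι p, ι e⟫_ℝ := by
    have := hperp _ (hU (k + 1).zero_le he0)
    rwa [inner_sub_left, sub_eq_zero] at this
  have h3 : ‖F‖ ^ 2 = ‖F - ι p‖ ^ 2 + ‖ι p‖ ^ 2 := by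
    have : F = (F - ι p) + ι p := by abel
    conv_lhs => rw [this, norm_add_sq_real, hperp p hp]
    ring
  have h4 : ‖F - ι p₀‖ ^ 2 = ‖F - ι p‖ ^ 2 + ‖ι (p - p₀)‖ ^ 2 := by
    have : F - ι p₀ = (F - ι p) + ι (p - p₀) := by rw [map_sub]; abel
    rw [this, norm_add_sq_real, hperp _ ((U (k + 1)).sub_mem hp hk)]
    ring
  have h5 : ‖F - ι p₀‖ ^ 2 ≤ ε / A := by
    have := pow_le_pow_left₀ (norm_nonneg _) hp₀.le 2
    rwa [Real.sq_sqrt (by positivity)] at this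
  have h6 : A * ‖F - ι p‖ ^ 2 ≤ ε := by
    have : ‖F - ι p‖ ^ 2 ≤ ε / A := by nlinarith [sq_nonneg ‖ι (p - p₀)‖]
    rw [le_div_iff₀ hA] at this
    linarith
  have := hE p
  rw [h1] at this
  rw [h3, h2]
  nlinarith

end Hilbert

/-! ### Derivatives of the density, of polynomials in u and of the cutoffs. -/

section Calculus

open MvPolynomial

variable {n : ℕ}

lemma orthant_eq_pi : orthant n = Set.univ.pi fun _ => Set.Ioi 0 := by
  ext x; simp [orthant]

lemma isOpen_orthant : IsOpen (orthant n) := by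
  rw [orthant_eq_pi]; exact isOpen_set_pi Set.finite_univ fun _ _ => isOpen_Ioi

lemma measurableSet_orthant : MeasurableSet (orthant n) := isOpen_orthant.measurableSet

lemma one_add_sum_pos {x : Fin n → ℝ} (hx : x ∈ orthant n) : 0 < 1 + ∑ i, x i := by
  have : 0 ≤ ∑ i, x i := Finset.sum_nonneg fun i _ => (hx i).le
  linarith

lemma le_one_add_sum {x : Fin n → ℝ} (hx : x ∈ orthant n) (i : Fin n) : x i ≤ 1 + ∑ j, x j := by
  have := Finset.single_le_sum (f := x) (fun j _ => (hx j).le) (Finset.mem_univ i)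
  linarith

lemma transportInv_apply (x : Fin n → ℝ) (i : Fin n) :
    transportInv x i = x i / (1 + ∑ j, x j) := by
  simp [transportInv, div_eq_inv_mul]

lemma transportInv_mem_Icc {x : Fin n → ℝ} (hx : x ∈ orthant n) :
    transportInv x ∈ Set.Icc (0 : Fin n → ℝ) 1 := by
  have h := one_add_sum_pos hx
  refine ⟨fun i => ?_, fun i => ?_⟩
  · rw [transportInv_apply]; exact div_nonneg (hx i).le h.le
  · rw [transportInv_apply]; exact (div_le_one h).2 (le_one_add_sum hx i)

lemma exists_abs_eval_transportInv_le (p : MvPolynomial (Fin n) ℝ) :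
    ∃ C, ∀ x ∈ orthant n, |eval (transportInv x) p| ≤ C := by
  obtain ⟨C, hC⟩ := (isCompact_Icc (a := (0 : Fin n → ℝ)) (b := 1)).exists_bound_of_continuousOn
    (MvPolynomial.continuous_eval p).continuousOn
  exact ⟨C, fun x hx => hC _ (transportInv_mem_Icc hx)⟩

lemma measurable_transportInv : Measurable (transportInv (n := n)) := by
  unfold transportInv
  fun_prop

lemma measurable_eval_transportInv (p : MvPolynomial (Fin n) ℝ) :
    Measurable fun x => eval (transportInv x) p :=
  (MvPolynomial.continuous_eval p).measurable.comp measurable_transportInv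

lemma contDiffAt_transportInv {x : Fin n → ℝ} (hx : x ∈ orthant n) :
    ContDiffAt ℝ ∞ (transportInv (n := n)) x := by
  unfold transportInv
  have := (one_add_sum_pos hx).ne'
  fun_prop (disch := assumption)

lemma contDiff_eval (p : MvPolynomial (Fin n) ℝ) : ContDiff ℝ ∞ fun x : Fin n → ℝ => eval x p := by
  induction p using MvPolynomial.induction_on with
  | C a => simpa using contDiff_const
  | add p q hp hq => simpa using hp.add hq
  | mul_X p i hp => simpa using hp.mul (contDiff_apply ℝ ℝ i)

lemma contDiffAt_eval_transportInv (p : MvPolynomial (Fin n) ℝ) {x : Fin n → ℝ}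
    (hx : x ∈ orthant n) : ContDiffAt ℝ ∞ (fun x => eval (transportInv x) p) x :=
  (contDiff_eval p).contDiffAt.comp x (contDiffAt_transportInv hx)

lemma hasDerivAt_line_apply (x : Fin n → ℝ) (i j : Fin n) (t : ℝ) :
    HasDerivAt (fun t : ℝ => (x + t • (Pi.single i 1 : Fin n → ℝ)) j) ((Pi.single i 1 : Fin n → ℝ) j) t := by
  simpa using ((hasDerivAt_id t).mul_const ((Pi.single i 1 : Fin n → ℝ) j)).const_add (x j)

lemma hasDerivAt_line_sum (x : Fin n → ℝ) (i : Fin n) (t : ℝ) :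
    HasDerivAt (fun t : ℝ => 1 + ∑ j, (x + t • (Pi.single i 1 : Fin n → ℝ)) j) 1 t := by
  have := HasDerivAt.fun_sum (u := Finset.univ) fun j _ => hasDerivAt_line_apply x i j t
  simpa using this.const_add 1

lemma eulerOp_mul (p q : MvPolynomial (Fin n) ℝ) :
    eulerOp (p * q) = eulerOp p * q + p * eulerOp q := by
  simp only [eulerOp_apply, pderiv_mul, Finset.sum_mul, Finset.mul_sum, ← Finset.sum_add_distrib]
  exact Finset.sum_congr rfl fun i _ => by ring

lemma gradOp_mul (i : Fin n) (p q : MvPolynomial (Fin n) ℝ) :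
    gradOp i (p * q) = gradOp i p * q + p * gradOp i q := by
  simp only [gradOp_apply, eulerOp_mul, pderiv_mul]; ring

lemma eulerOp_X (j : Fin n) : eulerOp (X j : MvPolynomial (Fin n) ℝ) = X j := by
  simp [eulerOp_apply, pderiv_X, Pi.single_apply]

/-- Both sides are derivations in p, so it suffices to treat a coordinate, where ∂ᵢuⱼ = (δᵢⱼ -
uⱼ)/(1+s). -/
lemma hasLineDerivAt_eval_transportInv (p : MvPolynomial (Fin n) ℝ) {x : Fin n → ℝ}
    (hx : x ∈ orthant n) (i : Fin n) :
    HasLineDerivAt ℝ (fun x => eval (transportInv x) p)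
      (eval (transportInv x) (gradOp i p) / (1 + ∑ j, x j)) x (Pi.single i 1) := by
  have hs := (one_add_sum_pos hx).ne'
  unfold HasLineDerivAt
  induction p using MvPolynomial.induction_on with
  | C a => simpa [gradOp_apply, eulerOp_apply] using hasDerivAt_const (0 : ℝ) a
  | add p q hp hq =>
    simp only [map_add, add_div]
    exact hp.add hq
  | mul_X p j hp =>
    have hX : HasDerivAt (fun t : ℝ => transportInv (x + t • (Pi.single i 1 : Fin n → ℝ)) j)
        (eval (transportInv x) (gradOp i (X j)) / (1 + ∑ j, x j)) 0 := by
      simp only [transportInv_apply]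
      refine ((hasDerivAt_line_apply x i j 0).div (hasDerivAt_line_sum x i 0)
        (by simpa using hs)).congr_deriv ?_
      simp only [zero_smul, add_zero, gradOp_apply, eulerOp_X, map_sub, eval_X, transportInv_apply]
      obtain rfl | h := eq_or_ne i j
      · simp only [Pi.single_eq_same, pderiv_X_self, map_one]
        field_simp
      · simp only [Pi.single_eq_of_ne h.symm, pderiv_X_of_ne h.symm, map_zero]
        field_simp
    simp only [map_mul, eval_X, gradOp_mul, map_add]
    refine (hp.mul hX).congr_deriv ?_
    simp only [zero_smul, add_zero]
    ring

/-- The unnormalized inverted Dirichlet density. -/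
noncomputable def invDensity (α : Fin n → ℝ) (A : ℝ) (x : Fin n → ℝ) : ℝ :=
  (∏ i, x i ^ (α i - 1)) * (1 + ∑ i, x i) ^ (-A)

lemma invDensity_pos (α : Fin n → ℝ) (A : ℝ) {x : Fin n → ℝ} (hx : x ∈ orthant n) :
    0 < invDensity α A x :=
  mul_pos (Finset.prod_pos fun i _ => Real.rpow_pos_of_pos (hx i) _)
    (Real.rpow_pos_of_pos (one_add_sum_pos hx) _)

lemma measurable_invDensity (α : Fin n → ℝ) (A : ℝ) : Measurable (invDensity α A) := by
  unfold invDensity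
  fun_prop

lemma contDiffAt_invDensity (α : Fin n → ℝ) (A : ℝ) {x : Fin n → ℝ} (hx : x ∈ orthant n) :
    ContDiffAt ℝ ∞ (invDensity α A) x := by
  unfold invDensity
  refine ContDiffAt.mul (contDiffAt_prod fun i _ => ?_) ?_
  · exact (contDiffAt_apply ℝ ℝ i x).rpow_const_of_ne (hx i).ne'
  · refine ContDiffAt.rpow_const_of_ne ?_ (one_add_sum_pos hx).ne'
    fun_prop

lemma hasLineDerivAt_invDensity (α : Fin n → ℝ) (A : ℝ) {x : Fin n → ℝ} (hx : x ∈ orthant n)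
    (i : Fin n) :
    HasLineDerivAt ℝ (invDensity α A)
      (invDensity α A x * ((α i - 1) / x i - A / (1 + ∑ j, x j))) x (Pi.single i 1) := by
  have hs := one_add_sum_pos hx
  have hxi := hx i
  have key : ∀ y : Fin n → ℝ, invDensity α A y =
      y i ^ (α i - 1) * (∏ j ∈ Finset.univ.erase i, y j ^ (α j - 1)) * (1 + ∑ j, y j) ^ (-A) := by
    intro y
    rw [Finset.mul_prod_erase _ (fun j => y j ^ (α j - 1)) (Finset.mem_univ i), invDensity]
  unfold HasLineDerivAt
  have hprod : ∀ t : ℝ, ∏ j ∈ Finset.univ.erase i, (x + t • (Pi.single i 1 : Fin n → ℝ)) j ^ (α j - 1) =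
      ∏ j ∈ Finset.univ.erase i, x j ^ (α j - 1) := fun t =>
    Finset.prod_congr rfl fun j hj => by simp [Pi.single_eq_of_ne (Finset.ne_of_mem_erase hj)]
  have h1 := (hasDerivAt_line_apply x i i 0).rpow_const (p := α i - 1)
    (Or.inl (by simpa using hxi.ne'))
  have h2 := (hasDerivAt_line_sum x i 0).rpow_const (p := -A) (Or.inl (by simpa using hs.ne'))
  simp only [key, hprod]
  refine ((h1.mul_const _).mul h2).congr_deriv ?_
  simp only [zero_smul, add_zero, Pi.single_eq_same]
  rw [Real.rpow_sub_one hxi.ne', Real.rpow_sub_one hs.ne']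
  field_simp
  ring

/-- A smooth exhaustion function of the orthant. -/
noncomputable def exhaustion (x : Fin n → ℝ) : ℝ := ∑ j, (x j + (x j)⁻¹)

lemma contDiffAt_exhaustion {x : Fin n → ℝ} (hx : x ∈ orthant n) :
    ContDiffAt ℝ ∞ (exhaustion (n := n)) x := by
  unfold exhaustion
  exact ContDiffAt.sum fun j _ =>
    (contDiffAt_apply ℝ ℝ j x).add ((contDiffAt_apply ℝ ℝ j x).inv (hx j).ne')

lemma hasLineDerivAt_exhaustion {x : Fin n → ℝ} (hx : x ∈ orthant n) (i : Fin n) :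
    HasLineDerivAt ℝ exhaustion (1 - (x i ^ 2)⁻¹) x (Pi.single i 1) := by
  unfold HasLineDerivAt exhaustion
  have h : ∀ j, HasDerivAt (fun t : ℝ => (x + t • (Pi.single i 1 : Fin n → ℝ)) j +
      ((x + t • (Pi.single i 1 : Fin n → ℝ)) j)⁻¹)
      ((Pi.single i 1 : Fin n → ℝ) j * (1 - (x j ^ 2)⁻¹)) 0 := fun j => by
    refine ((hasDerivAt_line_apply x i j 0).add ((hasDerivAt_line_apply x i j 0).inv
      (by simpa using (hx j).ne'))).congr_deriv ?_
    simp only [zero_smul, add_zero]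
    ring
  refine (HasDerivAt.fun_sum fun j _ => h j).congr_deriv ?_
  simp [Pi.single_apply]

lemma add_inv_le_exhaustion {x : Fin n → ℝ} (hx : x ∈ orthant n) (i : Fin n) :
    x i + (x i)⁻¹ ≤ exhaustion x :=
  Finset.single_le_sum (f := fun j => x j + (x j)⁻¹)
    (fun j _ => add_nonneg (hx j).le (inv_nonneg.2 (hx j).le)) (Finset.mem_univ i)

/-- The left side is |xᵢ∂ᵢ| of the exhaustion. Together with `exists_abs_deriv_stepDown_mul_le` this
bounds xᵢ∂ᵢ of the cutoff uniformly in its scale. -/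
lemma abs_sub_inv_le_exhaustion {x : Fin n → ℝ} (hx : x ∈ orthant n) (i : Fin n) :
    |x i - (x i)⁻¹| ≤ exhaustion x := by
  have h := add_inv_le_exhaustion hx i
  have h1 := hx i
  have h2 := inv_pos.2 h1
  rw [abs_le]
  constructor <;> linarith

/-- A smooth function which is `1` below `1` and `0` above `2`. -/
noncomputable def stepDown (y : ℝ) : ℝ := Real.smoothTransition (2 - y)

lemma contDiff_stepDown : ContDiff ℝ ∞ stepDown :=
  Real.smoothTransition.contDiff.comp (contDiff_const.sub contDiff_id)

lemma stepDown_eq_one {y : ℝ} (h : y ≤ 1) : stepDown y = 1 :=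
  Real.smoothTransition.one_of_one_le (by linarith)

lemma stepDown_eq_zero {y : ℝ} (h : 2 ≤ y) : stepDown y = 0 :=
  Real.smoothTransition.zero_of_nonpos (by linarith)

lemma abs_stepDown_le_one (y : ℝ) : |stepDown y| ≤ 1 := by
  rw [stepDown, abs_of_nonneg (Real.smoothTransition.nonneg _)]
  exact Real.smoothTransition.le_one _

lemma deriv_stepDown_eq_zero_of_lt {y : ℝ} (h : y < 1) : deriv stepDown y = 0 := by
  have : stepDown =ᶠ[nhds y] fun _ => 1 := by
    filter_upwards [Iio_mem_nhds h] with z hz using stepDown_eq_one (le_of_lt hz)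
  rw [this.deriv_eq, deriv_const]

lemma deriv_stepDown_eq_zero_of_gt {y : ℝ} (h : 2 < y) : deriv stepDown y = 0 := by
  have : stepDown =ᶠ[nhds y] fun _ => 0 := by
    filter_upwards [Ioi_mem_nhds h] with z hz using stepDown_eq_zero (le_of_lt hz)
  rw [this.deriv_eq, deriv_const]

lemma exists_abs_deriv_stepDown_mul_le : ∃ C, ∀ y, 0 ≤ y → |deriv stepDown y| * y ≤ C := by
  obtain ⟨C, hC⟩ := (isCompact_Icc (a := (0 : ℝ)) (b := 2)).exists_bound_of_continuousOn
    (contDiff_stepDown.continuous_deriv (by simp)).continuousOn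
  refine ⟨C * 2, fun y hy => ?_⟩
  have hC0 : 0 ≤ C := (norm_nonneg _).trans (hC 0 (by simp))
  by_cases h : y ≤ 2
  · exact mul_le_mul (hC y ⟨hy, h⟩) h hy hC0
  · rw [deriv_stepDown_eq_zero_of_gt (not_le.1 h)]
    simp [hC0]

/-- Ω and the complement of K form an open cover: the extension is h on the first and zero on the
second. -/
lemma contDiff_indicator_of_eq_zero {E : Type*} [NormedAddCommGroup E] [NormedSpace ℝ E]
    {Ω K : Set E} (hΩ : IsOpen Ω) (hK : IsCompact K) (hKΩ : K ⊆ Ω) {h : E → ℝ}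
    (hh : ∀ x ∈ Ω, ContDiffAt ℝ ∞ h x) (h0 : ∀ x ∈ Ω, x ∉ K → h x = 0) :
    ContDiff ℝ ∞ (Ω.indicator h) ∧ HasCompactSupport (Ω.indicator h) ∧
      tsupport (Ω.indicator h) ⊆ Ω := by
  have hsupp : ∀ x, x ∉ K → Ω.indicator h x = 0 := fun x hx => by
    by_cases hxΩ : x ∈ Ω
    · rw [Set.indicator_of_mem hxΩ, h0 x hxΩ hx]
    · exact Set.indicator_of_notMem hxΩ _
  have hts : tsupport (Ω.indicator h) ⊆ K :=
    closure_minimal (fun x hx => by_contra fun hxK => hx (hsupp x hxK)) hK.isClosed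
  refine ⟨contDiff_iff_contDiffAt.2 fun x => ?_, HasCompactSupport.intro hK hsupp,
    hts.trans hKΩ⟩
  by_cases hx : x ∈ Ω
  · exact (hh x hx).congr_of_eventuallyEq
      (Filter.eventually_of_mem (hΩ.mem_nhds hx) fun y hy => Set.indicator_of_mem hy h)
  · refine contDiffAt_const (c := (0 : ℝ)) |>.congr_of_eventuallyEq ?_
    filter_upwards [hK.isClosed.isOpen_compl.mem_nhds fun hxK => hx (hKΩ hxK)] with y hy
    exact hsupp y hy

/-- The compactly supported field used to test the weak gradient. -/
noncomputable def testField (α : Fin n → ℝ) (A : ℝ) (q : MvPolynomial (Fin n) ℝ) (i : Fin n)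
    (k : ℝ) (x : Fin n → ℝ) : ℝ :=
  stepDown (exhaustion x / k) * (invDensity α A x * (x i * eval (transportInv x) q))

lemma contDiffAt_testField (α : Fin n → ℝ) (A : ℝ) (q : MvPolynomial (Fin n) ℝ) (i : Fin n)
    (k : ℝ) {x : Fin n → ℝ} (hx : x ∈ orthant n) :
    ContDiffAt ℝ ∞ (testField α A q i k) x := by
  unfold testField
  exact (contDiff_stepDown.contDiffAt.comp x ((contDiffAt_exhaustion hx).div_const k)).mul
    ((contDiffAt_invDensity α A hx).mul
      ((contDiffAt_apply ℝ ℝ i x).mul (contDiffAt_eval_transportInv q hx)))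

/-- The factor xᵢ absorbs the singular term (αᵢ-1)/xᵢ of the logarithmic derivative of the density.
What does not differentiate the cutoff is exactly `divOp`, bounded on the orthant. -/
lemma hasLineDerivAt_testField (α : Fin n → ℝ) (A : ℝ) (q : MvPolynomial (Fin n) ℝ) (i : Fin n)
    (k : ℝ) {x : Fin n → ℝ} (hx : x ∈ orthant n) :
    HasLineDerivAt ℝ (testField α A q i k)
      (invDensity α A x * (stepDown (exhaustion x / k) * eval (transportInv x) (divOp α A i q) +
        deriv stepDown (exhaustion x / k) * ((x i - (x i)⁻¹) / k) * eval (transportInv x) q))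
      x (Pi.single i 1) := by
  have hs := one_add_sum_pos hx
  have hxi := hx i
  have h0 : x + (0 : ℝ) • (Pi.single i 1 : Fin n → ℝ) = x := by simp
  have h1 : HasDerivAt stepDown (deriv stepDown (exhaustion x / k))
      (exhaustion (x + (0 : ℝ) • (Pi.single i 1 : Fin n → ℝ)) / k) := by
    rw [h0]
    exact (contDiff_stepDown.differentiable (by simp) _).hasDerivAt
  have h2 := h1.comp 0 (HasDerivAt.div_const (hasLineDerivAt_exhaustion hx i) k)
  have h3 : HasDerivAt _ _ _ := hasLineDerivAt_invDensity α A hx i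
  have h4 : HasDerivAt _ _ _ := hasLineDerivAt_eval_transportInv q hx i
  have h5 := h2.mul (h3.mul ((hasDerivAt_line_apply x i i 0).mul h4))
  refine HasDerivAt.congr_deriv h5 ?_
  simp only [Pi.mul_apply, Function.comp_apply, h0, Pi.single_eq_same, divOp_apply, map_add, map_sub, map_mul, eval_X,
    smul_eval, transportInv_apply]
  field_simp
  ring

lemma testField_indicator (α : Fin n → ℝ) (A : ℝ) (q : MvPolynomial (Fin n) ℝ) (i : Fin n)
    {k : ℝ} (hk : 0 < k) :
    ContDiff ℝ ∞ ((orthant n).indicator (testField α A q i k)) ∧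
    HasCompactSupport ((orthant n).indicator (testField α A q i k)) ∧
      tsupport ((orthant n).indicator (testField α A q i k)) ⊆ orthant n := by
  -- Where the cutoff is nonzero the exhaustion is below 2k, so each xⱼ and each 1/xⱼ is below 2k:
  -- the point lies in this box.
  refine contDiff_indicator_of_eq_zero isOpen_orthant
    (isCompact_Icc (a := fun _ => (2 * k)⁻¹) (b := fun _ => 2 * k)) ?_
    (fun x hx => contDiffAt_testField α A q i k hx) ?_
  · intro x hx j
    exact lt_of_lt_of_le (by positivity) (hx.1 j)
  · intro x hx hxK
    rw [testField, stepDown_eq_zero, zero_mul]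
    by_contra! h
    rw [div_lt_iff₀ hk] at h
    refine hxK ⟨fun j => ?_, fun j => ?_⟩
    · have := add_inv_le_exhaustion hx j
      have h1 := hx j
      exact inv_le_of_inv_le₀ h1 (by linarith)
    · have := add_inv_le_exhaustion hx j
      have h1 := inv_pos.2 (hx j)
      change x j ≤ 2 * k
      linarith

end Calculus

/-! ### Measures given by a normalized density. -/

section NormalizedMeasure

variable {n : ℕ} {Ω : Set (Fin n → ℝ)} {ρ : (Fin n → ℝ) → ℝ}

lemma normalizedMeasure_absolutelyContinuous (Ω : Set (Fin n → ℝ)) (ρ : (Fin n → ℝ) → ℝ) :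
    normalizedMeasure Ω ρ ≪ volume.restrict Ω :=
  Measure.smul_absolutelyContinuous.trans (withDensity_absolutelyContinuous _ _)

lemma ae_mem_normalizedMeasure (hΩ : MeasurableSet Ω) :
    ∀ᵐ x ∂normalizedMeasure Ω ρ, x ∈ Ω :=
  (normalizedMeasure_absolutelyContinuous Ω ρ).ae_le (ae_restrict_mem hΩ)

lemma isProbabilityMeasure_normalizedMeasure (h0 : ∫⁻ x in Ω, ENNReal.ofReal (ρ x) ≠ 0)
    (h1 : ∫⁻ x in Ω, ENNReal.ofReal (ρ x) ≠ ⊤) :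
    IsProbabilityMeasure (normalizedMeasure Ω ρ) :=
  ⟨by simp [normalizedMeasure, ENNReal.inv_mul_cancel h0 h1]⟩

lemma integral_normalizedMeasure (hΩ : MeasurableSet Ω) (hρ : Measurable ρ)
    (hρ0 : ∀ x ∈ Ω, 0 ≤ ρ x) (F : (Fin n → ℝ) → ℝ) :
    ∫ x, F x ∂normalizedMeasure Ω ρ =
      (∫⁻ x in Ω, ENNReal.ofReal (ρ x))⁻¹.toReal * ∫ x in Ω, ρ x * F x := by
  rw [normalizedMeasure, integral_smul_measure,
    integral_withDensity_eq_integral_toReal_smul hρ.ennreal_ofReal (by simp), smul_eq_mul]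
  congr 1
  refine setIntegral_congr_fun hΩ fun x hx => ?_
  simp [ENNReal.toReal_ofReal (hρ0 x hx)]

end NormalizedMeasure

/-! ### Integration by parts for weak gradients, by truncation. -/

section IntegrationByParts

open MvPolynomial Filter Topology

variable {n : ℕ} {α : Fin n → ℝ} {α₀ : ℝ}

lemma ae_mem_orthant (α : Fin n → ℝ) (α₀ : ℝ) : ∀ᵐ x ∂invDirichlet α α₀, x ∈ orthant n :=
  ae_mem_normalizedMeasure measurableSet_orthant

lemma integral_invDirichlet (F : (Fin n → ℝ) → ℝ) :
    ∫ x, F x ∂invDirichlet α α₀ =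
      (∫⁻ x in orthant n, ENNReal.ofReal (invDensity α ((∑ i, α i) + α₀) x))⁻¹.toReal *
        ∫ x in orthant n, invDensity α ((∑ i, α i) + α₀) x * F x :=
  integral_normalizedMeasure measurableSet_orthant (measurable_invDensity _ _)
    (fun _ hx => (invDensity_pos _ _ hx).le) F

lemma _root_.MeasureTheory.Integrable.mul_bounded_on_orthant {f h : (Fin n → ℝ) → ℝ}
    (hf : Integrable f (invDirichlet α α₀)) (hm : Measurable h) {C : ℝ}
    (hC : ∀ x ∈ orthant n, |h x| ≤ C) : Integrable (fun x => f x * h x) (invDirichlet α α₀) :=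
  hf.mul_bdd (c := C) hm.aestronglyMeasurable ((ae_mem_orthant α α₀).mono hC)

lemma _root_.MeasureTheory.Integrable.mul_eval_transportInv {f : (Fin n → ℝ) → ℝ}
    (hf : Integrable f (invDirichlet α α₀)) (p : MvPolynomial (Fin n) ℝ) :
    Integrable (fun x => f x * eval (transportInv x) p) (invDirichlet α α₀) := by
  obtain ⟨C, hC⟩ := exists_abs_eval_transportInv_le p
  exact hf.mul_bounded_on_orthant (measurable_eval_transportInv p) hC

lemma measurable_exhaustion : Measurable (exhaustion (n := n)) := by
  unfold exhaustion
  fun_prop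

/-- Truncated integration by parts against a weak gradient. -/
lemma integral_weakGradient_truncated {f : (Fin n → ℝ) → ℝ} {g : (Fin n → ℝ) → Fin n → ℝ}
    (hw : IsWeakGradient (orthant n) f g) (q : MvPolynomial (Fin n) ℝ) (i : Fin n)
    {k : ℝ} (hk : 0 < k) :
    ∫ x, f x * (stepDown (exhaustion x / k) *
        eval (transportInv x) (divOp α ((∑ i, α i) + α₀) i q) +
        deriv stepDown (exhaustion x / k) * ((x i - (x i)⁻¹) / k) * eval (transportInv x) q)
        ∂invDirichlet α α₀ =
      -∫ x, g x i * x i * (stepDown (exhaustion x / k) * eval (transportInv x) q)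
        ∂invDirichlet α α₀ := by
  obtain ⟨h1, h2, h3⟩ := testField_indicator α ((∑ i, α i) + α₀) q i hk
  have h := hw.integral_eq i _ h1 h2 h3
  rw [integral_invDirichlet, integral_invDirichlet, ← mul_neg]
  congr 1
  convert h using 1
  · refine setIntegral_congr_fun measurableSet_orthant fun x hx => ?_
    have hev : (orthant n).indicator (testField α ((∑ i, α i) + α₀) q i k) =ᶠ[𝓝 x]
        testField α ((∑ i, α i) + α₀) q i k :=
      eventually_of_mem (isOpen_orthant.mem_nhds hx) fun y hy => Set.indicator_of_mem hy _
    have hd := ((contDiffAt_testField α ((∑ i, α i) + α₀) q i k hx).differentiableAt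
      (by simp)).lineDeriv_eq_fderiv (v := Pi.single i 1)
    rw [hev.fderiv_eq, ← hd, (hasLineDerivAt_testField α _ q i k hx).lineDeriv]
    ring
  · congr 1
    refine setIntegral_congr_fun measurableSet_orthant fun x hx => ?_
    simp only [Set.indicator_of_mem hx, testField]
    ring

lemma tendsto_exhaustion_div (x : Fin n → ℝ) :
    ∀ᶠ k : ℕ in atTop, exhaustion x / (k + 1 : ℝ) < 1 := by
  have : Tendsto (fun k : ℕ => exhaustion x / (k + 1 : ℝ)) atTop (𝓝 0) :=
    tendsto_const_nhds.div_atTop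
      (tendsto_atTop_add_const_right _ _ tendsto_natCast_atTop_atTop)
  exact this.eventually (gt_mem_nhds one_pos)

/-- Integration by parts of a weakly differentiable function against polynomials in
`x / (1 + s(x))`: no boundary terms occur. -/
theorem integral_weakGradient_mul_eval {f : (Fin n → ℝ) → ℝ} {g : (Fin n → ℝ) → Fin n → ℝ}
    (hw : IsWeakGradient (orthant n) f g) (hf : Integrable f (invDirichlet α α₀)) (i : Fin n)
    (hg : Integrable (fun x => g x i * x i) (invDirichlet α α₀)) (q : MvPolynomial (Fin n) ℝ) :
    ∫ x, g x i * x i * eval (transportInv x) q ∂invDirichlet α α₀ =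
      -∫ x, f x * eval (transportInv x) (divOp α ((∑ i, α i) + α₀) i q) ∂invDirichlet α α₀ := by
  set D := divOp α ((∑ i, α i) + α₀) i q with hD
  obtain ⟨C₁, hC₁⟩ := exists_abs_eval_transportInv_le q
  obtain ⟨C₂, hC₂⟩ := exists_abs_eval_transportInv_le D
  obtain ⟨C₃, hC₃⟩ := exists_abs_deriv_stepDown_mul_le
  have hms : ∀ k : ℕ, Measurable fun x : Fin n → ℝ => stepDown (exhaustion x / (k + 1 : ℝ)) :=
    fun k => contDiff_stepDown.continuous.measurable.comp (measurable_exhaustion.div_const _)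
  have hmd : ∀ k : ℕ, Measurable fun x : Fin n → ℝ =>
      deriv stepDown (exhaustion x / (k + 1 : ℝ)) * ((x i - (x i)⁻¹) / (k + 1 : ℝ)) := fun k =>
    ((measurable_deriv _).comp (measurable_exhaustion.div_const _)).mul (by fun_prop)
  have hae := ae_mem_orthant α α₀
  have hlim1 : Tendsto (fun k : ℕ => ∫ x, f x * (stepDown (exhaustion x / (k + 1 : ℝ)) *
        eval (transportInv x) D + deriv stepDown (exhaustion x / (k + 1 : ℝ)) *
        ((x i - (x i)⁻¹) / (k + 1 : ℝ)) * eval (transportInv x) q) ∂invDirichlet α α₀) atTop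
      (𝓝 (∫ x, f x * eval (transportInv x) D ∂invDirichlet α α₀)) := by
    -- C₂ bounds the divergence term and C₃C₁ the term with the differentiated cutoff, both
    -- independently of k.
    refine tendsto_integral_of_dominated_convergence (fun x => |f x| * (C₂ + C₃ * C₁)) ?_
      (hf.abs.mul_const _) ?_ ?_
    · intro k
      refine hf.aestronglyMeasurable.mul (Measurable.aestronglyMeasurable ?_)
      exact ((hms k).mul (measurable_eval_transportInv D)).add
        ((hmd k).mul (measurable_eval_transportInv q))
    · intro k
      filter_upwards [hae] with x hx
      rw [norm_mul, Real.norm_eq_abs, Real.norm_eq_abs]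
      refine mul_le_mul_of_nonneg_left ((abs_add_le _ _).trans (add_le_add ?_ ?_)) (abs_nonneg _)
      · rw [abs_mul]
        calc _ ≤ 1 * C₂ := mul_le_mul (abs_stepDown_le_one _) (hC₂ x hx) (abs_nonneg _) zero_le_one
          _ = C₂ := one_mul _
      · rw [abs_mul]
        have hk : (0 : ℝ) < k + 1 := by positivity
        have he : 0 ≤ exhaustion x / (k + 1 : ℝ) :=
          div_nonneg ((abs_nonneg _).trans (abs_sub_inv_le_exhaustion hx i)) hk.le
        have h1 : |deriv stepDown (exhaustion x / (k + 1 : ℝ)) *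
            ((x i - (x i)⁻¹) / (k + 1 : ℝ))| ≤ C₃ := by
          rw [abs_mul, abs_div, abs_of_pos hk]
          refine le_trans ?_ (hC₃ _ he)
          gcongr
          exact abs_sub_inv_le_exhaustion hx i
        exact mul_le_mul h1 (hC₁ x hx) (abs_nonneg _) ((abs_nonneg _).trans h1)
    · filter_upwards [hae] with x hx
      refine tendsto_const_nhds.congr' ?_
      -- At a fixed point the cutoff is eventually 1 with zero derivative, so the integrand is
      -- eventually constant in k.
      filter_upwards [tendsto_exhaustion_div x] with k hk
      rw [stepDown_eq_one hk.le, deriv_stepDown_eq_zero_of_lt hk]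
      ring
  have hlim2 : Tendsto (fun k : ℕ => ∫ x, g x i * x i * (stepDown (exhaustion x / (k + 1 : ℝ)) *
        eval (transportInv x) q) ∂invDirichlet α α₀) atTop
      (𝓝 (∫ x, g x i * x i * eval (transportInv x) q ∂invDirichlet α α₀)) := by
    refine tendsto_integral_of_dominated_convergence (fun x => |g x i * x i| * C₁) ?_
      (hg.abs.mul_const _) ?_ ?_
    · intro k
      exact hg.aestronglyMeasurable.mul
        ((hms k).mul (measurable_eval_transportInv q)).aestronglyMeasurable
    · intro k
      filter_upwards [hae] with x hx
      rw [norm_mul, Real.norm_eq_abs, Real.norm_eq_abs, abs_mul (stepDown _)]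
      refine mul_le_mul_of_nonneg_left ?_ (abs_nonneg _)
      calc _ ≤ 1 * C₁ := mul_le_mul (abs_stepDown_le_one _) (hC₁ x hx) (abs_nonneg _) zero_le_one
        _ = C₁ := one_mul _
    · filter_upwards [hae] with x hx
      refine tendsto_const_nhds.congr' ?_
      filter_upwards [tendsto_exhaustion_div x] with k hk
      rw [stepDown_eq_one hk.le]
      ring
  have heq : ∀ k : ℕ, _ := fun k : ℕ =>
    integral_weakGradient_truncated (α := α) (α₀ := α₀) hw q i (k := (k + 1 : ℝ)) (by positivity)
  have := tendsto_nhds_unique (hlim1.congr heq) hlim2.neg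
  linarith

end IntegrationByParts

/-! ### Polynomials in u as weakly differentiable functions. -/

section SmoothFunctions

open MvPolynomial

variable {n : ℕ}

/-- The classical gradient of `p ∘ transportInv`. -/
noncomputable def polyGrad (p : MvPolynomial (Fin n) ℝ) (x : Fin n → ℝ) (i : Fin n) : ℝ :=
  eval (transportInv x) (gradOp i p) / (1 + ∑ j, x j)

lemma continuousOn_eval_transportInv (p : MvPolynomial (Fin n) ℝ) :
    ContinuousOn (fun x => eval (transportInv x) p) (orthant n) := fun _ hx =>
  (contDiffAt_eval_transportInv p hx).continuousAt.continuousWithinAt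

lemma continuousOn_polyGrad (p : MvPolynomial (Fin n) ℝ) (i : Fin n) :
    ContinuousOn (fun x => polyGrad p x i) (orthant n) := by
  refine (continuousOn_eval_transportInv _).div (by fun_prop) fun x hx => (one_add_sum_pos hx).ne'

lemma integrable_mul_of_tsupport_subset {Ω : Set (Fin n → ℝ)}
    {u φ : (Fin n → ℝ) → ℝ} (hu : ContinuousOn u Ω) (hφ : Continuous φ)
    (hc : HasCompactSupport φ) (hs : tsupport φ ⊆ Ω) :
    Integrable (fun x => u x * φ x) volume := by
  refine (integrableOn_iff_integrable_of_support_subset (s := tsupport φ) ?_).1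
    (ContinuousOn.integrableOn_compact hc ((hu.mono hs).mul hφ.continuousOn))
  exact (Function.support_mul_subset_right _ _).trans (subset_tsupport φ)

lemma isWeakGradient_polyGrad (p : MvPolynomial (Fin n) ℝ) :
    IsWeakGradient (orthant n) (fun x => eval (transportInv x) p) (polyGrad p) where
  locallyIntegrableOn :=
    (continuousOn_eval_transportInv p).locallyIntegrableOn measurableSet_orthant
  locallyIntegrableOn_grad i :=
    (continuousOn_polyGrad p i).locallyIntegrableOn measurableSet_orthant
  integral_eq i φ hφ hc hs := by
    have hcd : HasCompactSupport fun x => fderiv ℝ φ x (Pi.single i 1) :=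
      hc.fderiv_apply ℝ (Pi.single i 1)
    have hsd : tsupport (fun x => fderiv ℝ φ x (Pi.single i 1)) ⊆ tsupport φ :=
      tsupport_fderiv_apply_subset ℝ (Pi.single i 1)
    have h0 : ∀ x, x ∉ orthant n → φ x = 0 := fun x hx =>
      image_eq_zero_of_notMem_tsupport fun h => hx (hs h)
    have h0d : ∀ x, x ∉ orthant n → fderiv ℝ φ x (Pi.single i 1) = 0 := fun x hx =>
      image_eq_zero_of_notMem_tsupport (f := fun x => fderiv ℝ φ x (Pi.single i 1))
        fun h => hx (hs (hsd h))
    -- The test function vanishes off the orthant, so one integrates over the whole space;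
    -- differentiability of the polynomial is then needed only on the support of φ.
    rw [setIntegral_eq_integral_of_forall_compl_eq_zero fun x hx => by rw [h0d x hx, mul_zero],
      setIntegral_eq_integral_of_forall_compl_eq_zero fun x hx => by rw [h0 x hx, mul_zero]]
    refine integral_bilinear_hasLineDerivAt_right_eq_neg_left_of_integrable
      (B := ContinuousLinearMap.mul ℝ ℝ) (v := Pi.single i 1) ?_ ?_ ?_ ?_ ?_
    · exact integrable_mul_of_tsupport_subset (continuousOn_polyGrad p i)
        hφ.continuous hc hs
    · exact integrable_mul_of_tsupport_subset (continuousOn_eval_transportInv p)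
        ((hφ.continuous_fderiv (by simp)).clm_apply continuous_const) hcd (hsd.trans hs)
    · exact integrable_mul_of_tsupport_subset (continuousOn_eval_transportInv p)
        hφ.continuous hc hs
    · exact fun x hx => hasLineDerivAt_eval_transportInv p (hs hx) i
    · exact fun x _ => (hφ.differentiable (by simp) x).hasFDerivAt.hasLineDerivAt _

end SmoothFunctions

/-! ### Finiteness and positivity of the normalizing constant. -/

section Normalization

variable {n : ℕ}

lemma integrableOn_rpow_mul_one_add_rpow {a δ : ℝ} (ha : 0 < a) (hδ : 0 < δ) :
    IntegrableOn (fun x : ℝ => x ^ (a - 1) * (1 + x) ^ (-(a + δ))) (Set.Ioi 0) := by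
  have hm : Measurable fun x : ℝ => x ^ (a - 1) * (1 + x) ^ (-(a + δ)) := by fun_prop
  rw [← Set.Ioc_union_Ioi_eq_Ioi zero_le_one]
  refine IntegrableOn.union ?_ ?_
  · have h : IntegrableOn (fun x : ℝ => x ^ (a - 1)) (Set.Ioc 0 1) := by
      rw [integrableOn_Ioc_iff_integrableOn_Ioo, intervalIntegral.integrableOn_Ioo_rpow_iff one_pos]
      linarith
    refine Integrable.mono' h hm.aestronglyMeasurable ?_
    filter_upwards [ae_restrict_mem measurableSet_Ioc] with x hx
    have hx0 : 0 < x := hx.1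
    rw [Real.norm_of_nonneg (by positivity)]
    refine mul_le_of_le_one_right (by positivity) ?_
    exact Real.rpow_le_one_of_one_le_of_nonpos (by linarith) (by linarith)
  · have h : IntegrableOn (fun x : ℝ => x ^ (-1 - δ)) (Set.Ioi 1) :=
      integrableOn_Ioi_rpow_of_lt (by linarith) one_pos
    refine Integrable.mono' h hm.aestronglyMeasurable ?_
    filter_upwards [ae_restrict_mem measurableSet_Ioi] with x hx
    have hx0 : (0 : ℝ) < x := one_pos.trans hx
    rw [Real.norm_of_nonneg (by positivity), show -1 - δ = (a - 1) + -(a + δ) by ring,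
      Real.rpow_add hx0]
    exact mul_le_mul_of_nonneg_left
      (Real.rpow_le_rpow_of_nonpos hx0 (by linarith) (by linarith)) (by positivity)

lemma one_add_apply_le {x : Fin n → ℝ} (hx : x ∈ orthant n) (i : Fin n) :
    1 + x i ≤ 1 + ∑ j, x j := by
  have := Finset.single_le_sum (f := x) (fun j _ => (hx j).le) (Finset.mem_univ i)
  linarith

/-- Share α₀ equally among the coordinates and use 1+s ≥ 1+xᵢ: the density is dominated by a product
of one-dimensional beta prime densities. -/
lemma integrableOn_invDensity [NeZero n] {α : Fin n → ℝ} {α₀ : ℝ} (hα : ∀ i, 0 < α i)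
    (hα₀ : 0 < α₀) : IntegrableOn (invDensity α ((∑ i, α i) + α₀)) (orthant n) := by
  have hn : (0 : ℝ) < n := Nat.cast_pos.2 (NeZero.pos n)
  have h : Integrable (fun x : Fin n → ℝ => ∏ i, x i ^ (α i - 1) * (1 + x i) ^ (-(α i + α₀ / n)))
      (volume.restrict (orthant n)) := by
    rw [orthant_eq_pi, volume_pi, Measure.restrict_pi_pi]
    exact Integrable.fintype_prod
      (f := fun i x => x ^ (α i - 1) * (1 + x) ^ (-(α i + α₀ / n)))
      fun i => integrableOn_rpow_mul_one_add_rpow (hα i) (by positivity)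
  refine Integrable.mono' h (measurable_invDensity _ _).aestronglyMeasurable ?_
  filter_upwards [ae_restrict_mem measurableSet_orthant] with x hx
  have hs := one_add_sum_pos hx
  rw [Real.norm_of_nonneg (invDensity_pos _ _ hx).le, invDensity, Finset.prod_mul_distrib]
  refine mul_le_mul_of_nonneg_left ?_ (Finset.prod_nonneg fun i _ => Real.rpow_nonneg (hx i).le _)
  have : -((∑ i, α i) + α₀) = ∑ i, -(α i + α₀ / n) := by
    rw [Finset.sum_neg_distrib, Finset.sum_add_distrib]
    simp
    field_simp
  rw [this, Real.rpow_sum_of_pos hs]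
  refine Finset.prod_le_prod (fun i _ => Real.rpow_nonneg hs.le _) fun i _ => ?_
  refine Real.rpow_le_rpow_of_nonpos (by linarith [hx i]) (one_add_apply_le hx i) ?_
  have := hα i
  have : 0 < α₀ / n := by positivity
  linarith

lemma lintegral_invDensity_ne_top [NeZero n] {α : Fin n → ℝ} {α₀ : ℝ} (hα : ∀ i, 0 < α i)
    (hα₀ : 0 < α₀) :
    ∫⁻ x in orthant n, ENNReal.ofReal (invDensity α ((∑ i, α i) + α₀) x) ≠ ⊤ :=
  (integrableOn_invDensity hα hα₀).lintegral_lt_top.ne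

lemma volume_orthant_ne_zero : volume (orthant n) ≠ 0 :=
  (isOpen_orthant.measure_pos volume ⟨fun _ => 1, fun _ => one_pos⟩).ne'

lemma lintegral_invDensity_ne_zero (α : Fin n → ℝ) (A : ℝ) :
    ∫⁻ x in orthant n, ENNReal.ofReal (invDensity α A x) ≠ 0 := by
  rw [← pos_iff_ne_zero, setLIntegral_pos_iff (measurable_invDensity _ _).ennreal_ofReal]
  have : Function.support (fun x => ENNReal.ofReal (invDensity α A x)) ∩ orthant n = orthant n := by
    refine Set.inter_eq_right.2 fun x hx => ?_
    simpa using invDensity_pos α A hx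
  rw [this]
  exact pos_iff_ne_zero.2 volume_orthant_ne_zero

lemma isProbabilityMeasure_invDirichlet [NeZero n] {α : Fin n → ℝ} {α₀ : ℝ} (hα : ∀ i, 0 < α i)
    (hα₀ : 0 < α₀) : IsProbabilityMeasure (invDirichlet α α₀) :=
  isProbabilityMeasure_normalizedMeasure (lintegral_invDensity_ne_zero _ _)
    (lintegral_invDensity_ne_top hα hα₀)

end Normalization

/-! ### The diffeomorphism T and the image of the Dirichlet distribution. -/

section Transport

variable {n : ℕ}

lemma openSimplex_eq : openSimplex n = orthant n ∩ {t | ∑ i, t i < 1} := by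
  ext t
  refine ⟨fun h => ⟨fun i => (h.1 i).1, h.2⟩, fun h => ⟨fun i => ⟨h.1 i, ?_⟩, h.2⟩⟩
  exact (Finset.single_le_sum (f := t) (fun j _ => (h.1 j).le) (Finset.mem_univ i)).trans_lt h.2

lemma measurableSet_openSimplex : MeasurableSet (openSimplex n) := by
  rw [openSimplex_eq]
  exact measurableSet_orthant.inter (measurableSet_lt (by fun_prop) measurable_const)

lemma one_sub_sum_pos {t : Fin n → ℝ} (ht : t ∈ openSimplex n) : 0 < 1 - ∑ i, t i :=
  sub_pos.2 ht.2

lemma transport_apply (t : Fin n → ℝ) (i : Fin n) :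
    transport t i = t i / (1 - ∑ j, t j) := by
  simp [transport, div_eq_inv_mul]

lemma one_add_sum_transport {t : Fin n → ℝ} (ht : t ∈ openSimplex n) :
    1 + ∑ i, transport t i = (1 - ∑ i, t i)⁻¹ := by
  have := (one_sub_sum_pos ht).ne'
  simp only [transport_apply, ← Finset.sum_div]
  field_simp
  ring

lemma one_sub_sum_transportInv {x : Fin n → ℝ} (hx : x ∈ orthant n) :
    1 - ∑ i, transportInv x i = (1 + ∑ i, x i)⁻¹ := by
  have := (one_add_sum_pos hx).ne'
  simp only [transportInv_apply, ← Finset.sum_div]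
  field_simp
  ring

lemma mapsTo_transport : Set.MapsTo (transport (n := n)) (openSimplex n) (orthant n) :=
  fun t ht i => by
    rw [transport_apply]
    exact div_pos (ht.1 i).1 (one_sub_sum_pos ht)

lemma mapsTo_transportInv : Set.MapsTo (transportInv (n := n)) (orthant n) (openSimplex n) :=
  fun x hx => by
    rw [openSimplex_eq]
    refine ⟨fun i => ?_, ?_⟩
    · rw [transportInv_apply]
      exact div_pos (hx i) (one_add_sum_pos hx)
    · have := one_sub_sum_transportInv hx
      have h := inv_pos.2 (one_add_sum_pos hx)
      change ∑ i, transportInv x i < 1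
      linarith

lemma invOn_transport :
    Set.InvOn (transportInv (n := n)) transport (openSimplex n) (orthant n) := by
  constructor
  · intro t ht
    have h := (one_sub_sum_pos ht).ne'
    ext i
    rw [transportInv_apply, one_add_sum_transport ht, transport_apply]
    field_simp
  · intro x hx
    have h := (one_add_sum_pos hx).ne'
    ext i
    rw [transport_apply, one_sub_sum_transportInv hx, transportInv_apply]
    field_simp

lemma contDiffOn_transport : ContDiffOn ℝ ∞ (transport (n := n)) (openSimplex n) := by
  intro t ht
  have := (one_sub_sum_pos ht).ne'
  unfold transport
  fun_prop (disch := assumption)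

lemma contDiffOn_transportInv : ContDiffOn ℝ ∞ (transportInv (n := n)) (orthant n) :=
  fun _ hx => (contDiffAt_transportInv hx).contDiffWithinAt

lemma measurable_transport : Measurable (transport (n := n)) := by
  unfold transport
  fun_prop

/-- The derivative of the transport map. -/
noncomputable def transportDeriv (t : Fin n → ℝ) : (Fin n → ℝ) →L[ℝ] (Fin n → ℝ) :=
  (1 - ∑ i, t i)⁻¹ • ContinuousLinearMap.id ℝ (Fin n → ℝ) +
    (((1 - ∑ i, t i) ^ 2)⁻¹ •
      ∑ i, ContinuousLinearMap.proj (R := ℝ) (φ := fun _ : Fin n => ℝ) i).smulRight t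

lemma hasFDerivAt_transport {t : Fin n → ℝ} (ht : t ∈ openSimplex n) :
    HasFDerivAt (transport (n := n)) (transportDeriv t) t := by
  have h0 := (one_sub_sum_pos ht).ne'
  have h1 : HasFDerivAt (fun t : Fin n → ℝ => 1 - ∑ i, t i)
      (-∑ i, ContinuousLinearMap.proj (R := ℝ) (φ := fun _ : Fin n => ℝ) i) t :=
    (HasFDerivAt.fun_sum fun i _ => hasFDerivAt_apply i t).const_sub 1
  have h2 := (hasDerivAt_inv h0).comp_hasFDerivAt t h1
  refine (h2.smul (hasFDerivAt_id t)).congr_fderiv ?_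
  ext v i
  simp [transportDeriv]

lemma toMatrix_transportDeriv (t : Fin n → ℝ) :
    LinearMap.toMatrix' (transportDeriv t : (Fin n → ℝ) →ₗ[ℝ] (Fin n → ℝ)) =
      (1 - ∑ i, t i)⁻¹ • (1 + Matrix.vecMulVec ((1 - ∑ i, t i)⁻¹ • t) 1) := by
  ext i j
  simp only [LinearMap.toMatrix'_apply, Matrix.smul_apply, Matrix.add_apply, Matrix.one_apply,
    Matrix.vecMulVec_apply, transportDeriv]
  generalize (1 - ∑ i, t i) = c
  simp [Pi.single_apply]
  split_ifs <;> ring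

/-- The Jacobian is c⁻¹ times a rank-one perturbation of the identity, with c = 1-∑tᵢ; the matrix
determinant lemma gives c⁻ⁿ(1+(1-c)/c). -/
lemma det_transportDeriv {t : Fin n → ℝ} (ht : t ∈ openSimplex n) :
    (transportDeriv t).det = ((1 - ∑ i, t i)⁻¹) ^ (n + 1) := by
  have h0 := (one_sub_sum_pos ht).ne'
  rw [ContinuousLinearMap.det, ← LinearMap.det_toMatrix', toMatrix_transportDeriv,
    Matrix.det_smul, Matrix.vecMulVec_eq Unit, Matrix.det_one_add_replicateCol_mul_replicateRow,
    Fintype.card_fin, pow_succ]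
  congr 1
  simp only [dotProduct, Pi.one_apply, one_mul, Pi.smul_apply, smul_eq_mul, ← Finset.mul_sum]
  field_simp
  ring

/-- The unnormalized Dirichlet density. -/
noncomputable def simplexDensity (α : Fin n → ℝ) (α₀ : ℝ) (t : Fin n → ℝ) : ℝ :=
  (∏ i, t i ^ (α i - 1)) * (1 - ∑ i, t i) ^ (α₀ - 1)

lemma dirichlet_snoc (α : Fin n → ℝ) (α₀ : ℝ) :
    dirichlet (Fin.snoc (α := fun _ => ℝ) α α₀) =
      normalizedMeasure (openSimplex n) (simplexDensity α α₀) := by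
  simp only [dirichlet, Fin.snoc_castSucc, Fin.snoc_last]
  rfl

lemma det_mul_invDensity_transport (α : Fin n → ℝ) (α₀ : ℝ) {t : Fin n → ℝ}
    (ht : t ∈ openSimplex n) :
    |(transportDeriv t).det| * invDensity α ((∑ i, α i) + α₀) (transport t) =
      simplexDensity α α₀ t := by
  have h0 := one_sub_sum_pos ht
  rw [det_transportDeriv ht, abs_of_pos (by positivity), invDensity, one_add_sum_transport ht]
  set c := 1 - ∑ i, t i with hc
  have h1 : ∏ i, transport t i ^ (α i - 1) = (∏ i, t i ^ (α i - 1)) * c ^ (n - ∑ i, α i) := by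
    have : (n : ℝ) - ∑ i, α i = ∑ i, -(α i - 1) := by
      simp [Finset.sum_sub_distrib]
    rw [this, Real.rpow_sum_of_pos h0, ← Finset.prod_mul_distrib]
    refine Finset.prod_congr rfl fun i _ => ?_
    rw [transport_apply, Real.div_rpow (ht.1 i).1.le h0.le, Real.rpow_neg h0.le, div_eq_mul_inv]
  have h2 : (c⁻¹) ^ (n + 1) = c ^ (-(n + 1 : ℝ)) := by
    rw [Real.rpow_neg h0.le, inv_pow]
    norm_cast
  rw [h1, h2, Real.inv_rpow h0.le, Real.rpow_neg h0.le ((∑ i, α i) + α₀), inv_inv, simplexDensity, ← hc]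
  -- The powers of c come from the Jacobian, from the coordinates tᵢ/c, and from 1+s = 1/c.
  have h3 : c ^ (α₀ - 1) =
      c ^ (-(n + 1 : ℝ)) * c ^ (n - ∑ i, α i) * c ^ ((∑ i, α i) + α₀) := by
    rw [← Real.rpow_add h0, ← Real.rpow_add h0]
    congr 1
    ring
  rw [h3]
  ring

/-- Change of variables for the unnormalized densities; the whole space as S shows that the two
normalizing constants agree. -/
lemma setLIntegral_simplexDensity (α : Fin n → ℝ) (α₀ : ℝ) {S : Set (Fin n → ℝ)}
    (hS : MeasurableSet S) :
    ∫⁻ t in transport ⁻¹' S ∩ openSimplex n, ENNReal.ofReal (simplexDensity α α₀ t) =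
      ∫⁻ x in S ∩ orthant n, ENNReal.ofReal (invDensity α ((∑ i, α i) + α₀) x) := by
  have himage : transport '' (transport ⁻¹' S ∩ openSimplex n) = S ∩ orthant n := by
    rw [Set.image_preimage_inter]
    congr 1
    exact Set.BijOn.image_eq (Set.InvOn.bijOn invOn_transport mapsTo_transport mapsTo_transportInv)
  have hm : MeasurableSet (transport ⁻¹' S ∩ openSimplex n) :=
    (measurable_transport hS).inter measurableSet_openSimplex
  rw [← himage, lintegral_image_eq_lintegral_abs_det_fderiv_mul volume hm
    (fun t ht => (hasFDerivAt_transport ht.2).hasFDerivWithinAt)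
    (invOn_transport.1.injOn.mono Set.inter_subset_right)]
  refine setLIntegral_congr_fun hm fun t ht => ?_
  rw [← ENNReal.ofReal_mul (abs_nonneg _), det_mul_invDensity_transport α α₀ ht.2]

lemma lintegral_simplexDensity (α : Fin n → ℝ) (α₀ : ℝ) :
    ∫⁻ t in openSimplex n, ENNReal.ofReal (simplexDensity α α₀ t) =
      ∫⁻ x in orthant n, ENNReal.ofReal (invDensity α ((∑ i, α i) + α₀) x) := by
  simpa using setLIntegral_simplexDensity α α₀ MeasurableSet.univ

lemma map_dirichlet (α : Fin n → ℝ) (α₀ : ℝ) :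
    (dirichlet (Fin.snoc (α := fun _ => ℝ) α α₀)).map transport = invDirichlet α α₀ := by
  rw [dirichlet_snoc]
  ext S hS
  rw [Measure.map_apply measurable_transport hS]
  change _ = normalizedMeasure (orthant n) (invDensity α ((∑ i, α i) + α₀)) S
  simp only [normalizedMeasure, Measure.smul_apply]
  rw [withDensity_apply _ hS, withDensity_apply _ (measurable_transport hS),
    Measure.restrict_restrict hS, Measure.restrict_restrict (measurable_transport hS),
    setLIntegral_simplexDensity α α₀ hS, lintegral_simplexDensity]

lemma isProbabilityMeasure_dirichlet [NeZero n] {α : Fin n → ℝ} {α₀ : ℝ} (hα : ∀ i, 0 < α i)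
    (hα₀ : 0 < α₀) :
    IsProbabilityMeasure (dirichlet (Fin.snoc (α := fun _ => ℝ) α α₀)) := by
  rw [dirichlet_snoc]
  refine isProbabilityMeasure_normalizedMeasure ?_ ?_
  · rw [lintegral_simplexDensity]; exact lintegral_invDensity_ne_zero _ _
  · rw [lintegral_simplexDensity]; exact lintegral_invDensity_ne_top hα hα₀

end Transport

/-! ### The transported weight. -/

section Weight

open Matrix

variable {n : ℕ}

lemma jacobian_transport {t : Fin n → ℝ} (ht : t ∈ openSimplex n) :
    jacobian transport t = (1 - ∑ i, t i)⁻¹ • (1 + vecMulVec ((1 - ∑ i, t i)⁻¹ • t) 1) := by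
  rw [jacobian, (hasFDerivAt_transport ht).fderiv, toMatrix_transportDeriv]

lemma invWeight_transport {t : Fin n → ℝ} (ht : t ∈ openSimplex n) :
    invWeight (transport t) =
      jacobian transport t * simplexWeight t * (jacobian transport t).transpose := by
  have h0 := (one_sub_sum_pos ht).ne'
  rw [invWeight, one_add_sum_transport ht, jacobian_transport ht]
  set c := 1 - ∑ i, t i with hc
  have hsum : ∑ i, t i = 1 - c := by rw [hc]; ring
  -- Since 1ᵀW_τ = c tᵀ, the rank-one part of the Jacobian cancels the term t tᵀ of W_τ.
  have h1 : (c⁻¹ • (1 + vecMulVec (c⁻¹ • t) 1)) * simplexWeight t = c⁻¹ • diagonal t := by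
    rw [Matrix.smul_mul, Matrix.add_mul, Matrix.one_mul, vecMulVec_mul]
    congr 1
    have : vecMul 1 (simplexWeight t) = c • t := by
      ext j
      simp only [simplexWeight, vecMul_sub, vecMul_diagonal, Pi.sub_apply, Pi.one_apply, one_mul,
        vecMul_vecMulVec, Pi.smul_apply, smul_eq_mul, dotProduct, hsum]
      ring
    rw [this, simplexWeight]
    ext i j
    simp [vecMulVec_apply]
    field_simp
    ring
  rw [h1]
  ext i j
  simp [Matrix.mul_apply, diagonal_apply, vecMulVec_apply, transport_apply, ← hc, Matrix.one_apply]
  by_cases h : i = j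
  · subst h
    simp
    field_simp
  · simp [h]
    field_simp

lemma posDef_invWeight {x : Fin n → ℝ} (hx : x ∈ orthant n) : (invWeight x).PosDef := by
  refine PosDef.smul ?_ (one_add_sum_pos hx)
  refine PosDef.add_posSemidef (PosDef.diagonal hx) ?_
  simpa using posSemidef_vecMulVec_self_star x

lemma sqNorm_invWeight (x v : Fin n → ℝ) :
    sqNorm (invWeight x) v =
      (1 + ∑ i, x i) * (∑ i, x i * v i ^ 2 + (∑ i, x i * v i) ^ 2) := by
  simp only [sqNorm, invWeight, smul_mulVec, add_mulVec, smul_dotProduct, add_dotProduct,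
    vecMulVec_mulVec, smul_eq_mul]
  congr 2
  · simp only [dotProduct, mulVec_diagonal]
    exact Finset.sum_congr rfl fun i _ => by ring
  · simp [dotProduct, sq, Finset.mul_sum, mul_assoc, mul_comm]

end Weight

/-! ### Density of polynomials in u in L². -/

section Density

open MvPolynomial

variable {n : ℕ}

/-- Stone–Weierstrass: the coordinates separate points. -/
lemma exists_eval_near_on_cube {h : (Fin n → ℝ) → ℝ} (hh : Continuous h) {ε : ℝ} (hε : 0 < ε) :
    ∃ p : MvPolynomial (Fin n) ℝ, ∀ t ∈ Set.Icc (0 : Fin n → ℝ) 1, |h t - eval t p| ≤ ε := by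
  let φ : MvPolynomial (Fin n) ℝ →ₐ[ℝ] C(Fin n → ℝ, ℝ) :=
    aeval fun i => (⟨fun x => x i, continuous_apply i⟩ : C(Fin n → ℝ, ℝ))
  have hφ : ∀ p x, φ p x = eval x p := fun p x => by
    induction p using MvPolynomial.induction_on with
    | C a => simp [φ]
    | add p q hp hq => simp [hp, hq]
    | mul_X p i hp => simp [hp, φ]
  have hsep : φ.range.SeparatesPoints := fun x y hxy => by
    obtain ⟨i, hi⟩ := Function.ne_iff.1 hxy
    exact ⟨_, ⟨φ (X i), ⟨X i, rfl⟩, rfl⟩, by simpa [hφ] using hi⟩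
  obtain ⟨_, ⟨p, rfl⟩, hp⟩ :=
    ContinuousMap.exists_mem_subalgebra_near_continuous_of_isCompact_of_separatesPoints hsep
      ⟨h, hh⟩ (isCompact_Icc (a := (0 : Fin n → ℝ)) (b := 1)) hε
  refine ⟨p, fun t ht => ?_⟩
  have := (hp t ht).le
  rw [abs_sub_comm]
  exact (congrArg (fun y => |y - h t|) (hφ p t)).symm.le.trans this

/-- Polynomials in `x / (1 + s(x))` are dense in `L²` of the inverted Dirichlet distribution. -/
theorem exists_eval_transportInv_near [NeZero n] {α : Fin n → ℝ} {α₀ : ℝ} (hα : ∀ i, 0 < α i)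
    (hα₀ : 0 < α₀) {f : (Fin n → ℝ) → ℝ} (hf : MemLp f 2 (invDirichlet α α₀)) {ε : ℝ}
    (hε : 0 < ε) :
    ∃ p : MvPolynomial (Fin n) ℝ,
      eLpNorm (f - fun x => eval (transportInv x) p) 2 (invDirichlet α α₀) ≤ ENNReal.ofReal ε := by
  set ν := dirichlet (Fin.snoc (α := fun _ => ℝ) α α₀) with hν
  have hprob : IsProbabilityMeasure ν := isProbabilityMeasure_dirichlet hα hα₀
  have hmap : ν.map transport = invDirichlet α α₀ := map_dirichlet α α₀
  rw [← hmap] at hf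
  have hfT := (memLp_map_measure_iff hf.1 measurable_transport.aemeasurable).1 hf
  -- On the simplex side u is the identity coordinate. Half of ε pays for a continuous approximation
  -- in L², half for a uniform polynomial one, the measure having mass one.
  obtain ⟨h, -, hh, hc, hhm⟩ := hfT.exists_hasCompactSupport_eLpNorm_sub_le (by simp)
    (ε := ENNReal.ofReal (ε / 2)) (by simpa using hε)
  obtain ⟨p, hp⟩ := exists_eval_near_on_cube hc (half_pos hε)
  refine ⟨p, ?_⟩
  have hae : ∀ᵐ t ∂ν, t ∈ openSimplex n := ae_mem_normalizedMeasure measurableSet_openSimplex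
  rw [← hmap, eLpNorm_map_measure
    (hf.1.sub (measurable_eval_transportInv p).aestronglyMeasurable)
    measurable_transport.aemeasurable]
  have hcong : (f - fun x => eval (transportInv x) p) ∘ transport =ᵐ[ν]
      (f ∘ transport - h) + fun t => h t - eval t p := by
    filter_upwards [hae] with t ht
    simp [invOn_transport.1 ht]
  have hpm : AEStronglyMeasurable (fun t => h t - eval t p) ν :=
    (hc.sub (MvPolynomial.continuous_eval p)).aestronglyMeasurable
  rw [eLpNorm_congr_ae hcong]
  calc eLpNorm ((f ∘ transport - h) + fun t => h t - eval t p) 2 ν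
      ≤ eLpNorm (f ∘ transport - h) 2 ν + eLpNorm (fun t => h t - eval t p) 2 ν :=
        eLpNorm_add_le (hfT.1.sub hhm.1) hpm (by norm_num)
    _ ≤ ENNReal.ofReal (ε / 2) + ENNReal.ofReal (ε / 2) := by
        refine add_le_add hh ?_
        refine (eLpNorm_le_of_ae_bound (C := ε / 2) ?_).trans (by simp)
        filter_upwards [hae] with t ht
        exact hp t ⟨fun i => (ht.1 i).1.le, fun i => (ht.1 i).2.le⟩
    _ = ENNReal.ofReal ε := by
        rw [← ENNReal.ofReal_add (by positivity) (by positivity), add_halves]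

end Density

/-! ### The energy form and Green's formula. -/

section Energy

open MvPolynomial

variable {n : ℕ} {α : Fin n → ℝ} {α₀ : ℝ}

/-- The bilinear form `⟨W(x) v, w⟩` of the inverted Dirichlet weight. -/
def energyForm (x v w : Fin n → ℝ) : ℝ :=
  (1 + ∑ i, x i) * (∑ i, x i * v i * w i + (∑ i, x i * v i) * ∑ i, x i * w i)

lemma energyForm_self (x v : Fin n → ℝ) :
    energyForm x v v = (1 + ∑ i, x i) * (∑ i, x i * v i ^ 2 + (∑ i, x i * v i) ^ 2) := by
  simp only [energyForm, sq, mul_assoc]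

lemma energyForm_comm (x v w : Fin n → ℝ) : energyForm x v w = energyForm x w v := by
  simp only [energyForm, mul_right_comm, mul_comm (∑ i, x i * v i)]

lemma energyForm_sub_self (x v w : Fin n → ℝ) :
    energyForm x (v - w) (v - w) =
      energyForm x v v - 2 * energyForm x v w + energyForm x w w := by
  have h1 : ∑ i, x i * (v - w) i * (v - w) i =
      ∑ i, x i * v i * v i - 2 * ∑ i, x i * v i * w i + ∑ i, x i * w i * w i := by
    rw [Finset.mul_sum, ← Finset.sum_sub_distrib, ← Finset.sum_add_distrib]
    exact Finset.sum_congr rfl fun i _ => by simp only [Pi.sub_apply]; ring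
  have h2 : ∑ i, x i * (v - w) i = ∑ i, x i * v i - ∑ i, x i * w i := by
    rw [← Finset.sum_sub_distrib]
    exact Finset.sum_congr rfl fun i _ => by simp only [Pi.sub_apply]; ring
  simp only [energyForm, h1, h2]
  ring

lemma energyForm_self_nonneg {x : Fin n → ℝ} (hx : x ∈ orthant n) (v : Fin n → ℝ) :
    0 ≤ energyForm x v v := by
  rw [energyForm_self]
  exact mul_nonneg (one_add_sum_pos hx).le (add_nonneg
    (Finset.sum_nonneg fun i _ => mul_nonneg (hx i).le (sq_nonneg _)) (sq_nonneg _))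

/-- Keep one term of the first sum and use xᵢ ≤ 1+s. Finite energy thus makes gᵢxᵢ integrable, which
is what integration by parts asks of g. -/
lemma sq_mul_le_energyForm {x : Fin n → ℝ} (hx : x ∈ orthant n) (v : Fin n → ℝ) (i : Fin n) :
    (v i * x i) ^ 2 ≤ energyForm x v v := by
  rw [energyForm_self]
  have h1 : x i * v i ^ 2 ≤ ∑ j, x j * v j ^ 2 := Finset.single_le_sum
    (f := fun j => x j * v j ^ 2) (fun j _ => mul_nonneg (hx j).le (sq_nonneg _))
    (Finset.mem_univ i)
  calc (v i * x i) ^ 2 = x i * (x i * v i ^ 2) := by ring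
    _ ≤ (1 + ∑ j, x j) * (∑ j, x j * v j ^ 2 + (∑ j, x j * v j) ^ 2) := by
      refine mul_le_mul (le_one_add_sum hx i) (by linarith [sq_nonneg (∑ j, x j * v j)])
        (mul_nonneg (hx i).le (sq_nonneg _)) (one_add_sum_pos hx).le

/-- Pairing x with the gradient of p(u) gives (Ep)(u)/(1+s), E being the Euler operator. The
rank-one part of W therefore cancels the Euler term of `gradOp`, and the i-th component of W∇p is xᵢ
∂ᵢp(u). -/
lemma energyForm_polyGrad {x : Fin n → ℝ} (hx : x ∈ orthant n) (v : Fin n → ℝ)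
    (p : MvPolynomial (Fin n) ℝ) :
    energyForm x v (polyGrad p x) = ∑ i, v i * x i * eval (transportInv x) (pderiv i p) := by
  have hs := (one_add_sum_pos hx).ne'
  have he : eval (transportInv x) (eulerOp p) =
      (∑ i, x i * eval (transportInv x) (pderiv i p)) / (1 + ∑ i, x i) := by
    rw [eulerOp_apply, map_sum, Finset.sum_div]
    refine Finset.sum_congr rfl fun i _ => ?_
    rw [map_mul, eval_X, transportInv_apply]
    ring
  have h1 : ∑ i, x i * polyGrad p x i = eval (transportInv x) (eulerOp p) / (1 + ∑ i, x i) := by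
    have : ∀ i, x i * polyGrad p x i = (x i * eval (transportInv x) (pderiv i p)) /
        (1 + ∑ i, x i) - x i * (eval (transportInv x) (eulerOp p) / (1 + ∑ i, x i)) := fun i => by
      rw [polyGrad, gradOp_apply, map_sub]; ring
    simp only [this, Finset.sum_sub_distrib, ← Finset.sum_div, ← Finset.sum_mul, ← he]
    field_simp
    ring
  rw [energyForm, h1, Finset.sum_mul, ← Finset.sum_add_distrib, Finset.mul_sum]
  refine Finset.sum_congr rfl fun i _ => ?_
  rw [polyGrad, gradOp_apply, map_sub]
  field_simp
  ring

lemma integrable_energyForm_polyGrad {g : (Fin n → ℝ) → Fin n → ℝ}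
    (hg : ∀ i, Integrable (fun x => g x i * x i) (invDirichlet α α₀))
    (p : MvPolynomial (Fin n) ℝ) :
    Integrable (fun x => energyForm x (g x) (polyGrad p x)) (invDirichlet α α₀) := by
  have : Integrable (fun x => ∑ i, g x i * x i * eval (transportInv x) (pderiv i p))
      (invDirichlet α α₀) :=
    integrable_finsetSum _ fun i _ => (hg i).mul_eval_transportInv _
  refine this.congr ?_
  filter_upwards [ae_mem_orthant α α₀] with x hx
  rw [energyForm_polyGrad hx]

/-- Green's formula for a weakly differentiable function and a polynomial in `x / (1 + s(x))`. -/
lemma integral_energyForm_polyGrad {f : (Fin n → ℝ) → ℝ} {g : (Fin n → ℝ) → Fin n → ℝ}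
    (hw : IsWeakGradient (orthant n) f g) (hf : Integrable f (invDirichlet α α₀))
    (hg : ∀ i, Integrable (fun x => g x i * x i) (invDirichlet α α₀))
    (p : MvPolynomial (Fin n) ℝ) :
    ∫ x, energyForm x (g x) (polyGrad p x) ∂invDirichlet α α₀ =
      -∫ x, f x * eval (transportInv x) (generator α ((∑ i, α i) + α₀) p)
        ∂invDirichlet α α₀ := by
  have h1 : ∫ x, energyForm x (g x) (polyGrad p x) ∂invDirichlet α α₀ =
      ∫ x, ∑ i, g x i * x i * eval (transportInv x) (pderiv i p) ∂invDirichlet α α₀ := by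
    refine integral_congr_ae ?_
    filter_upwards [ae_mem_orthant α α₀] with x hx
    rw [energyForm_polyGrad hx]
  rw [h1, integral_finsetSum _ fun i _ => (hg i).mul_eval_transportInv _]
  simp only [integral_weakGradient_mul_eval hw hf _ (hg _), Finset.sum_neg_distrib,
    generator_apply, map_sum, Finset.mul_sum]
  rw [integral_finsetSum _ fun i _ => hf.mul_eval_transportInv _]

lemma integrable_polyGrad_mul [IsFiniteMeasure (invDirichlet α α₀)]
    (p : MvPolynomial (Fin n) ℝ) (i : Fin n) :
    Integrable (fun x => polyGrad p x i * x i) (invDirichlet α α₀) := by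
  have : Integrable (fun x => (1 : ℝ) * eval (transportInv x) (gradOp i p * X i))
      (invDirichlet α α₀) := (integrable_const _).mul_eval_transportInv _
  refine this.congr (Filter.Eventually.of_forall fun x => ?_)
  simp only [map_mul, eval_X, transportInv_apply, polyGrad]
  ring

lemma integrable_weakGradient_mul [IsFiniteMeasure (invDirichlet α α₀)]
    {f : (Fin n → ℝ) → ℝ} {g : (Fin n → ℝ) → Fin n → ℝ} (hw : IsWeakGradient (orthant n) f g)
    (hE : Integrable (fun x => energyForm x (g x) (g x)) (invDirichlet α α₀)) (i : Fin n) :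
    Integrable (fun x => g x i * x i) (invDirichlet α α₀) := by
  have hm : AEStronglyMeasurable (fun x => g x i) (invDirichlet α α₀) :=
    (hw.locallyIntegrableOn_grad i).aestronglyMeasurable.mono_ac
      (normalizedMeasure_absolutelyContinuous _ _)
  refine Integrable.mono' ((integrable_const (1 : ℝ)).add hE)
    (hm.mul (measurable_pi_apply i).aestronglyMeasurable) ?_
  filter_upwards [ae_mem_orthant α α₀] with x hx
  have h := sq_mul_le_energyForm hx (g x) i
  rw [Real.norm_eq_abs]
  simp only [Pi.add_apply]
  have h2 := sq_abs (g x i * x i)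
  -- This is |y| ≤ 1 + y² for y = gᵢxᵢ.
  nlinarith [sq_nonneg (|g x i * x i| - 1), abs_nonneg (g x i * x i)]

lemma memLp_eval_transportInv [IsFiniteMeasure (invDirichlet α α₀)]
    (p : MvPolynomial (Fin n) ℝ) :
    MemLp (fun x => eval (transportInv x) p) 2 (invDirichlet α α₀) := by
  obtain ⟨C, hC⟩ := exists_abs_eval_transportInv_le p
  exact MemLp.of_bound (measurable_eval_transportInv p).aestronglyMeasurable C
    ((ae_mem_orthant α α₀).mono hC)

lemma integrable_eval_transportInv [IsFiniteMeasure (invDirichlet α α₀)]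
    (p : MvPolynomial (Fin n) ℝ) :
    Integrable (fun x => eval (transportInv x) p) (invDirichlet α α₀) :=
  (memLp_eval_transportInv p).integrable one_le_two

end Energy

/-! ### The Poincaré inequality in L² and its extremal function. -/

section Poincare

open MvPolynomial
open scoped InnerProductSpace

variable {n : ℕ} {α : Fin n → ℝ} {α₀ : ℝ}

lemma real_inner_toLp {Ω : Type*} [MeasurableSpace Ω] {μ : Measure Ω} {f g : Ω → ℝ}
    (hf : MemLp f 2 μ) (hg : MemLp g 2 μ) :
    ⟪hf.toLp f, hg.toLp g⟫_ℝ = ∫ x, f x * g x ∂μ := by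
  rw [L2.inner_def]
  refine integral_congr_ae ?_
  filter_upwards [hf.coeFn_toLp, hg.coeFn_toLp] with x h1 h2
  rw [h1, h2]
  simp [mul_comm]

/-- Polynomials in `x / (1 + s(x))` as elements of `L²`. -/
noncomputable def polyToLp (α : Fin n → ℝ) (α₀ : ℝ) [IsFiniteMeasure (invDirichlet α α₀)] :
    MvPolynomial (Fin n) ℝ →ₗ[ℝ] Lp ℝ 2 (invDirichlet α α₀) where
  toFun p := (memLp_eval_transportInv p).toLp _
  map_add' p q := by
    rw [← MemLp.toLp_add]
    simp [Pi.add_def]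
  map_smul' c p := by
    rw [RingHom.id_apply, ← MemLp.toLp_const_smul]
    simp [Pi.smul_def]

lemma integral_energyForm_polyGrad_polyGrad [IsFiniteMeasure (invDirichlet α α₀)]
    (p q : MvPolynomial (Fin n) ℝ) :
    ∫ x, energyForm x (polyGrad p x) (polyGrad q x) ∂invDirichlet α α₀ =
      -∫ x, eval (transportInv x) p * eval (transportInv x) (generator α ((∑ i, α i) + α₀) q)
        ∂invDirichlet α α₀ :=
  integral_energyForm_polyGrad (isWeakGradient_polyGrad p)
    (integrable_eval_transportInv p) (integrable_polyGrad_mul p) q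

theorem variance_le_energy [NeZero n] (hα : ∀ i, 0 < α i) (hα₀ : 0 < α₀)
    {f : (Fin n → ℝ) → ℝ} {g : (Fin n → ℝ) → Fin n → ℝ}
    (hf : MemLp f 2 (invDirichlet α α₀)) (hw : IsWeakGradient (orthant n) f g)
    (hE : Integrable (fun x => energyForm x (g x) (g x)) (invDirichlet α α₀)) :
    ((∑ i, α i) + α₀) * (∫ x, f x ^ 2 ∂invDirichlet α α₀ - (∫ x, f x ∂invDirichlet α α₀) ^ 2) ≤
      ∫ x, energyForm x (g x) (g x) ∂invDirichlet α α₀ := by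
  have hprob := isProbabilityMeasure_invDirichlet hα hα₀
  have hA : 0 < (∑ i, α i) + α₀ := add_pos_of_nonneg_of_pos
    (Finset.sum_nonneg fun i _ => (hα i).le) hα₀
  set A := (∑ i, α i) + α₀ with hAdef
  have hfi : Integrable f (invDirichlet α α₀) := hf.integrable (by norm_num)
  have hgi := integrable_weakGradient_mul hw hE
  have hinner : ∀ p q, ⟪polyToLp α α₀ p, polyToLp α α₀ q⟫_ℝ =
      ∫ x, eval (transportInv x) p * eval (transportInv x) q ∂invDirichlet α α₀ := fun p q =>
    real_inner_toLp (memLp_eval_transportInv p) (memLp_eval_transportInv q)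
  have hinnerF : ∀ q, ⟪hf.toLp f, polyToLp α α₀ q⟫_ℝ =
      ∫ x, f x * eval (transportInv x) q ∂invDirichlet α α₀ := fun q =>
    real_inner_toLp hf (memLp_eval_transportInv q)
  have hone : ‖polyToLp α α₀ 1‖ = 1 := by
    have : ‖polyToLp α α₀ 1‖ ^ 2 = 1 := by
      rw [← real_inner_self_eq_norm_sq, hinner]
      simp
    nlinarith [norm_nonneg (polyToLp α α₀ 1)]
  have key := poincare_of_triangular (polyToLp α α₀) (generator α A) (degreeLE n) degreeLE_mono
    exists_mem_degreeLE A hA 1 hone (by simpa using generator_C α A 1)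
    (by simpa using monomial_mem_degreeLE (a := (0 : Fin n →₀ ℕ)) (m := 0) (by simp))
    (fun p hp => by
      obtain ⟨c, rfl⟩ := mem_degreeLE_zero hp
      exact ⟨c, by simp [smul_eq_C_mul]⟩)
    -- The generator is symmetric because the energy form is.
    (fun p q => by
      rw [real_inner_comm (polyToLp α α₀ q), hinner, hinner, ← neg_inj,
        ← integral_energyForm_polyGrad_polyGrad, ← integral_energyForm_polyGrad_polyGrad]
      simp only [energyForm_comm])
    (fun m p hp => generator_add_mem α A hp) (hf.toLp f)
    (fun ε hε => by
      obtain ⟨p, hp⟩ := exists_eval_transportInv_near hα hα₀ hf (half_pos hε)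
      refine ⟨p, ?_⟩
      have h1 : hf.toLp f - polyToLp α α₀ p = (hf.sub (memLp_eval_transportInv p)).toLp _ :=
        (MemLp.toLp_sub hf (memLp_eval_transportInv p)).symm
      rw [h1, Lp.norm_toLp]
      have := ENNReal.toReal_mono (by simp) hp
      rw [ENNReal.toReal_ofReal (by positivity)] at this
      linarith)
    (∫ x, energyForm x (g x) (g x) ∂invDirichlet α α₀)
    (fun p => by
      have h1 := integral_energyForm_polyGrad hw hfi hgi p
      have h2 := integral_energyForm_polyGrad_polyGrad (α := α) (α₀ := α₀) p p
      have i1 := integrable_energyForm_polyGrad hgi p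
      have i2 := integrable_energyForm_polyGrad
        (integrable_polyGrad_mul (α := α) (α₀ := α₀) p) p
      -- Expanded with Green's formula for f and for p, this is the inequality `hE` of the abstract
      -- theorem.
      have h3 : 0 ≤ ∫ x, energyForm x (g x - polyGrad p x) (g x - polyGrad p x)
          ∂invDirichlet α α₀ := integral_nonneg_of_ae <| by
        filter_upwards [ae_mem_orthant α α₀] with x hx using energyForm_self_nonneg hx _
      simp only [energyForm_sub_self] at h3
      have i3 : Integrable (fun x => energyForm x (g x) (g x) -
          2 * energyForm x (g x) (polyGrad p x)) (invDirichlet α α₀) := hE.sub (i1.const_mul 2)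
      rw [integral_add i3 i2, integral_sub hE (i1.const_mul 2),
        integral_const_mul, h1, h2] at h3
      rw [hinner, hinnerF]
      linarith)
  rw [hinnerF, ← real_inner_self_eq_norm_sq, real_inner_toLp] at key
  simpa [sq] using key

/-- The energy of the first coordinate on the simplex is `A` times its variance. -/
lemma energy_coordinate [IsProbabilityMeasure (invDirichlet α α₀)] (i : Fin n) :
    ∫ x, energyForm x (polyGrad (X i) x) (polyGrad (X i) x) ∂invDirichlet α α₀ =
      ((∑ i, α i) + α₀) * (∫ x, transportInv x i ^ 2 ∂invDirichlet α α₀ -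
        (∫ x, transportInv x i ∂invDirichlet α α₀) ^ 2) := by
  set A := (∑ i, α i) + α₀ with hAdef
  have hgen : generator α A (X i) = C (α i) - C A * X i := by
    rw [generator_apply, Finset.sum_eq_single i]
    · rw [pderiv_X_self, divOp_apply, gradOp_apply, eulerOp_apply]
      simp [smul_eq_C_mul]
    · intro j _ hj
      rw [pderiv_X_of_ne hj.symm, map_zero]
    · simp
  have hu : Integrable (fun x => transportInv x i) (invDirichlet α α₀) := by
    have := integrable_eval_transportInv (α := α) (α₀ := α₀) (X i)
    simpa only [eval_X] using this
  have hu2 : Integrable (fun x => transportInv x i ^ 2) (invDirichlet α α₀) := by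
    have := integrable_eval_transportInv (α := α) (α₀ := α₀) (X i ^ 2)
    simpa only [map_pow, eval_X] using this
  -- Testing Lu = αᵢ - Au against 1 gives the mean αᵢ/A; testing against u gives the energy.
  have h1 := integral_energyForm_polyGrad_polyGrad (α := α) (α₀ := α₀) 1 (X i)
  have h2 := integral_energyForm_polyGrad_polyGrad (α := α) (α₀ := α₀) (X i) (X i)
  rw [← hAdef, hgen] at h1 h2
  have hg1 : ∀ x : Fin n → ℝ, polyGrad 1 x = 0 := fun x => by
    ext j; simp [polyGrad, gradOp_apply, eulerOp_apply]
  have h0 : ∀ x v : Fin n → ℝ, energyForm x 0 v = 0 := fun x v => by simp [energyForm]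
  simp only [hg1, h0, integral_zero, map_one, one_mul, map_sub, map_mul, eval_C, eval_X] at h1
  rw [integral_sub (integrable_const _) (hu.const_mul _), integral_const_mul, integral_const] at h1
  simp only [probReal_univ, one_smul] at h1
  have h3 : ∀ x : Fin n → ℝ, eval (transportInv x) (X i) *
      eval (transportInv x) (C (α i) - C A * X i) =
      α i * transportInv x i - A * transportInv x i ^ 2 := fun x => by
    simp only [map_sub, map_mul, eval_C, eval_X]; ring
  simp only [h3] at h2
  rw [integral_sub (hu.const_mul _) (hu2.const_mul _), integral_const_mul,
    integral_const_mul] at h2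
  rw [h2]
  have : α i = A * ∫ x, transportInv x i ∂invDirichlet α α₀ := by linarith
  rw [this]
  ring

/-- The i-th partial derivative of uᵢ is (1-uᵢ)/(1+s), nonzero on the whole orthant. This makes the
variance of uᵢ positive, so that it can be divided out for optimality. -/
lemma energy_coordinate_pos [IsProbabilityMeasure (invDirichlet α α₀)] (i : Fin n) :
    0 < ∫ x, energyForm x (polyGrad (X i) x) (polyGrad (X i) x) ∂invDirichlet α α₀ := by
  have hpos : ∀ x ∈ orthant n, 0 < energyForm x (polyGrad (X i) x) (polyGrad (X i) x) := by
    intro x hx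
    refine lt_of_lt_of_le (sq_pos_of_pos (mul_pos ?_ (hx i))) (sq_mul_le_energyForm hx _ i)
    rw [polyGrad, gradOp_apply, pderiv_X_self, eulerOp_X, map_sub, map_one, eval_X]
    exact div_pos (sub_pos.2 ((mapsTo_transportInv hx).1 i).2) (one_add_sum_pos hx)
  have hae := ae_mem_orthant α α₀
  have hnonneg := hae.mono fun x hx => (hpos x hx).le
  refine lt_of_le_of_ne (integral_nonneg_of_ae hnonneg) fun h => ?_
  have h0 := (integral_eq_zero_iff_of_nonneg_ae hnonneg
    (integrable_energyForm_polyGrad (integrable_polyGrad_mul (X i)) (X i))).1 h.symm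
  obtain ⟨x, hx, hx0⟩ := (hae.and h0).exists
  exact (hpos x hx).ne' hx0

end Poincare

end InvDirichlet

/-! ### The main theorem. -/

theorem mainTheorem8 (n : ℕ) (hn : 1 ≤ n) (α : Fin n → ℝ) (α₀ : ℝ)
    (hα : ∀ i, 0 < α i) (hα₀ : 0 < α₀) :
    -- both distributions are probability measures
    IsProbabilityMeasure (InvDirichlet.invDirichlet α α₀) ∧
    IsProbabilityMeasure
      (InvDirichlet.dirichlet (Fin.snoc (α := fun _ => ℝ) α α₀)) ∧
    -- `T` is a diffeomorphism from the simplex onto the orthant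
    Set.MapsTo InvDirichlet.transport (InvDirichlet.openSimplex n) (InvDirichlet.orthant n) ∧
    Set.MapsTo InvDirichlet.transportInv (InvDirichlet.orthant n) (InvDirichlet.openSimplex n) ∧
    Set.InvOn InvDirichlet.transportInv InvDirichlet.transport
      (InvDirichlet.openSimplex n) (InvDirichlet.orthant n) ∧
    ContDiffOn ℝ ∞ (InvDirichlet.transport (n := n)) (InvDirichlet.openSimplex n) ∧
    ContDiffOn ℝ ∞ (InvDirichlet.transportInv (n := n)) (InvDirichlet.orthant n) ∧
    -- it transports the Dirichlet distribution and its weight to the inverted Dirichlet ones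
    (InvDirichlet.dirichlet (Fin.snoc (α := fun _ => ℝ) α α₀)).map InvDirichlet.transport =
      InvDirichlet.invDirichlet α α₀ ∧
    (∀ t ∈ InvDirichlet.openSimplex n,
      InvDirichlet.invWeight (InvDirichlet.transport t) =
        InvDirichlet.jacobian InvDirichlet.transport t * InvDirichlet.simplexWeight t *
          (InvDirichlet.jacobian InvDirichlet.transport t).transpose) ∧
    -- the weight takes values in the positive definite matrices
    (∀ x ∈ InvDirichlet.orthant n, (InvDirichlet.invWeight x).PosDef) ∧
    -- the weighted Poincaré inequality, written out
    (∀ (f : (Fin n → ℝ) → ℝ) (g : (Fin n → ℝ) → Fin n → ℝ),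
      MemLp f 2 (InvDirichlet.invDirichlet α α₀) →
      InvDirichlet.IsWeakGradient (InvDirichlet.orthant n) f g →
      Integrable (fun x => (1 + ∑ i, x i) *
        (∑ i, x i * g x i ^ 2 + (∑ i, x i * g x i) ^ 2)) (InvDirichlet.invDirichlet α α₀) →
      ∫ x, f x ^ 2 ∂(InvDirichlet.invDirichlet α α₀)
          - (∫ x, f x ∂(InvDirichlet.invDirichlet α α₀)) ^ 2 ≤
        1 / ((∑ i, α i) + α₀) *
          ∫ x, (1 + ∑ i, x i) * (∑ i, x i * g x i ^ 2 + (∑ i, x i * g x i) ^ 2)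
            ∂(InvDirichlet.invDirichlet α α₀)) ∧
    -- the constant is optimal: it is the smallest admissible one
    IsLeast {C : ℝ | InvDirichlet.WeightedPoincare (InvDirichlet.orthant n)
        (InvDirichlet.invDirichlet α α₀) InvDirichlet.invWeight C}
      (1 / ((∑ i, α i) + α₀)) := by
  have : NeZero n := ⟨by omega⟩
  have hA : 0 < (∑ i, α i) + α₀ := add_pos_of_nonneg_of_pos
    (Finset.sum_nonneg fun i _ => (hα i).le) hα₀
  have hprob := InvDirichlet.isProbabilityMeasure_invDirichlet hα hα₀
  have hpoincare : ∀ (f : (Fin n → ℝ) → ℝ) (g : (Fin n → ℝ) → Fin n → ℝ),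
      MemLp f 2 (InvDirichlet.invDirichlet α α₀) →
      InvDirichlet.IsWeakGradient (InvDirichlet.orthant n) f g →
      Integrable (fun x => (1 + ∑ i, x i) *
        (∑ i, x i * g x i ^ 2 + (∑ i, x i * g x i) ^ 2)) (InvDirichlet.invDirichlet α α₀) →
      ∫ x, f x ^ 2 ∂(InvDirichlet.invDirichlet α α₀)
          - (∫ x, f x ∂(InvDirichlet.invDirichlet α α₀)) ^ 2 ≤
        1 / ((∑ i, α i) + α₀) *
          ∫ x, (1 + ∑ i, x i) * (∑ i, x i * g x i ^ 2 + (∑ i, x i * g x i) ^ 2)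
            ∂(InvDirichlet.invDirichlet α α₀) := by
    intro f g hf hw hE
    simp only [← InvDirichlet.energyForm_self] at hE ⊢
    rw [one_div, inv_mul_eq_div, le_div_iff₀ hA, mul_comm]
    exact InvDirichlet.variance_le_energy hα hα₀ hf hw hE
  refine ⟨hprob, InvDirichlet.isProbabilityMeasure_dirichlet hα hα₀,
    InvDirichlet.mapsTo_transport, InvDirichlet.mapsTo_transportInv,
    InvDirichlet.invOn_transport, InvDirichlet.contDiffOn_transport,
    InvDirichlet.contDiffOn_transportInv, InvDirichlet.map_dirichlet α α₀,
    fun t ht => InvDirichlet.invWeight_transport ht, fun x hx => InvDirichlet.posDef_invWeight hx,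
    hpoincare, ⟨one_div_pos.2 hA, fun f g hf hw hE => ?_⟩, fun C hC => ?_⟩
  · simp only [InvDirichlet.sqNorm_invWeight] at hE ⊢
    exact hpoincare f g hf hw hE
  -- The coordinate uᵢ gives equality at 1/A: any admissible C satisfies Var(uᵢ) ≤ C·A·Var(uᵢ) with
  -- positive variance.
  · let i : Fin n := 0
    have h := hC.2 _ _ (InvDirichlet.memLp_eval_transportInv (MvPolynomial.X i))
      (InvDirichlet.isWeakGradient_polyGrad (MvPolynomial.X i)) (by
        simp only [InvDirichlet.sqNorm_invWeight, ← InvDirichlet.energyForm_self]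
        exact InvDirichlet.integrable_energyForm_polyGrad
          (InvDirichlet.integrable_polyGrad_mul (MvPolynomial.X i)) (MvPolynomial.X i))
    have hpos := InvDirichlet.energy_coordinate_pos (α := α) (α₀ := α₀) i
    simp only [InvDirichlet.sqNorm_invWeight, ← InvDirichlet.energyForm_self,
      MvPolynomial.eval_X] at h
    rw [InvDirichlet.energy_coordinate] at h hpos
    have hvar := pos_of_mul_pos_right hpos hA.le
    rw [div_le_iff₀ hA]
    exact le_of_mul_le_mul_right (by linarith) hvar
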